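/- **Setting.** Let $R$ be a (not necessarily commutative) domain, $n\ge 0$, and let $\mathsf R:=R[Y_1;\alpha_1,\delta_1]\cdots[Y_n;\alpha_n,\delta_n]$ be a multivariate Ore extension: $\alpha_1,\dots,\alpha_n$ are injective ring endomorphisms of $R$, each $\delta_i$ is an $\alpha_i$-derivation of $R$ (additive, with $\delta_i(rs)=\alpha_i(r)\delta_i(s)+\delta_i(r)s$), $\alpha_i\alpha_j=\alpha_j\alpha_i$ and $\delta_i\delta_j=\delta_j\delta_i$ for all $i,j$, $\alpha_j\delta_i=\delta_i\alpha_j$ for $i\ne j$; $\mathsf R$ is the ring which is a free left $R$-module on the terms $\mathcal T=\{Y_1^{a_1}\cdots Y_n^{a_n}\}$ and whose multiplication $\star$ is determined by $Y_i\star Y_j=Y_j\star Y_i=Y_iY_j$ and $Y_i\star r=\alpha_i(r)Y_i+\delta_i(r)$ for $r\in R$. Its associated graded Ore extension $\mathsf S:=G(\mathsf R)=R[Y_1;\alpha_1]\cdots[Y_n;\alpha_n]$ (same $\alpha_i$, all derivations $0$) has the same underlying left $R$-module; its multiplication is denoted $\ast$. Write $\circ$ for the commutative multiplication of $\mathcal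 T$ and for its action on the terms $\mathcal T^{(m)}=\{t\mathbf e_i: t\in\mathcal T,\ 1\le i\le m\}$ of $\mathsf R^m$. Let $\prec$ be a term ordering on $\mathcal T$ (a well-ordering with $\omega_1\prec\omega_2\Rightarrow\omega\omega_1\prec\omega\omega_2$) and $<$ a $\prec$-compatible term ordering on $\mathcal T^{(m)}$, i.e. a well-ordering such that $t_1<t_2\Rightarrow\omega\circ t_1<\omega\circ t_2$ and $\omega_1\prec\omega_2\Rightarrow\omega_1\circ t<\omega_2\circ t$ for all $\omega,\omega_1,\omega_2\in\mathcal T$, $t,t_1,t_2\in\mathcal T^{(m)}$. For $f\ne0$ in $\mathsf R^m$ (or in $\mathsf R$, with respect to $\prec$) let $\mathbf T(f)$ be its maximal term and $\mathbf M(f)$ its maximal monomial, i.e. $\mathbf T(f)$ times its coefficient in $f$. Conditions on $\mathbf T$ of a product $l_i\star g_i$ or of $l_i$ below are imposed only for $l_i\neq0$. Let $F=\{g_1,\dots,g_u\}\subset\mathsf R^m\setminus\{0\}$ be a finite generating set of the left module $\mathsf M\subset\mathsf R^m$. * $F$ is a *left (weak) Gröbner basis* of $\mathsf M$ if $\mathbf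 M\{\mathsf M\}=\mathbf M_L(\mathsf M)=\mathbf M\{N\}=N\cap\{\text{monomials } ct : c\in R\setminus\{0\},\ t\in\mathcal T^{(m)}\}$, where $\mathbf M\{X\}=\{\mathbf M(f): 0\ne f\in X\}$, $\mathbf M_L(X)=\{\mathbf M(a\lambda\star f):a\in R\setminus\{0\},\lambda\in\mathcal T,0\ne f\in X\}$ and $N$ is the left $\mathsf S$-submodule of $\mathsf S^m$ generated by $\mathbf M(g_1),\dots,\mathbf M(g_u)$. * $f\in\mathsf R^m$ has a *left Gröbner representation* in terms of $F$ if $f=\sum_{i=1}^u l_i\star g_i$ with $l_i\in\mathsf R$ and $\mathbf T(l_i)\circ\mathbf T(g_i)\le\mathbf T(f)$ for each $i$ (for $f=0$: all $l_i=0$). * $\mathfrak S_L:\mathsf R^u\to\mathsf R^m$, $(h_i)\mapsto\sum_i h_i\star g_i$, and $\mathfrak s_L:\mathsf S^u\to\mathsf S^m$, $(h_i)\mapsto\sum_i h_i\ast\mathbf M(g_i)$. * For $0\ne\sigma=(h_i)\in\mathsf R^u$: $v(\sigma)=\max_<\mathbf T(h_i\star g_i)$ over the $i$ with $h_i\ne0$,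 and the leading form $\mathcal L_L(\sigma)\in\mathsf S^u$ has $i$-th entry $\mathbf M(h_i)$ if $\mathbf T(h_i\star g_i)=v(\sigma)$ and $0$ otherwise; $\mathcal L_L(0)=0$. * $\sigma=(h_i)\in\mathsf S^u$ is *$\mathcal T^{(m)}$-homogeneous* if there is $t\in\mathcal T^{(m)}$ with $\omega\circ\mathbf T(g_i)=t$ for every $i$ and every term $\omega$ occurring in $h_i$. * A *left Gebauer–Möller set* for $F$ is any set of $\mathcal T^{(m)}$-homogeneous elements generating the left $\mathsf S$-module $\ker\mathfrak s_L$. * For homogeneous $\sigma$, $\mathfrak S_L(\sigma)$ has a *left quasi-Gröbner representation* if $\mathfrak S_L(\sigma)=\sum_{i=1}^u l_i\star g_i$ with $\mathbf T(l_i\star g_i)<v(\sigma)$ for each $i$ (for $\sigma=0$: all $l_i=0$). * A homogeneous $\sigma\in\ker\mathfrak s_L$ *has a lifting* if there is $U\in\ker\mathfrak S_L$ with $\mathcal L_L(U)=\sigma$. **Theorem (Möller; Left Lifting Theorem).** Let $\mathfrak{GM}(F)$ be any left Gebauer–Möller set for $F$. The following conditions are equivalent: 1. $F$ is a left (weak)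 Gröbner basis of $\mathsf M$; 2. for every $f\in\mathsf R^m$: $f\in\mathsf M$ if and only if $f$ has a left Gröbner representation in terms of $F$; 3. for each $\sigma\in\mathfrak{GM}(F)$, the S-polynomial $\mathfrak S_L(\sigma)$ has a left quasi-Gröbner representation in terms of $F$; 4. each $\sigma\in\mathfrak{GM}(F)$ has a lifting; 5. each $\mathcal T^{(m)}$-homogeneous element of $\ker\mathfrak s_L$ has a lifting. -/

import Mathlib

open Finset

noncomputable section

/-- The data `(αᵢ, δᵢ)`, `1 ≤ i ≤ n`, on the coefficient ring `R` that define a multivariate Ore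
extension `R[Y₁; α₁, δ₁]⋯[Yₙ; αₙ, δₙ]`: injective ring endomorphisms `αᵢ` and `αᵢ`-derivations `δᵢ`
of `R` which commute (apart from the pairs `αᵢ, δᵢ` with the same index).  The requirements
`αⱼ(Yᵢ) = Yᵢ`, `δⱼ(Yᵢ) = 0` for `i < j` say how `αⱼ, δⱼ` extend from `R` to
`R[Y₁; α₁, δ₁]⋯[Yⱼ₋₁; αⱼ₋₁, δⱼ₋₁]`. -/
structure OreData (R : Type*) [Ring R] (n : ℕ) where
  α : Fin n → R →+* R
  δ : Fin n → R →+ R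
  α_injective : ∀ i, Function.Injective (α i)
  δ_mul : ∀ i r s, δ i (r * s) = α i r * δ i s + δ i r * s
  α_comm : ∀ i j r, α i (α j r) = α j (α i r)
  δ_comm : ∀ i j r, δ i (δ j r) = δ j (δ i r)
  α_δ_comm : ∀ i j, i ≠ j → ∀ r, α j (δ i r) = δ i (α j r)

namespace OreData

variable {R : Type*} [Ring R] {n : ℕ}

/-- The data of the associated graded Ore extension: same `α`, zero derivations. -/
def graded (D : OreData R n) : OreData R n where
  α := D.α
  δ := 0
  α_injective := D.α_injective
  δ_mul := by simp
  α_comm := D.α_comm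
  δ_comm := by simp
  α_δ_comm := by simp

/-- The multivariate Ore extension `R[Y₁; α₁, δ₁]⋯[Yₙ; αₙ, δₙ]`: as a left `R`-module it is free on
the terms `Y^a`, `a ∈ ℕⁿ`; its multiplication is defined below. -/
def Ext (_D : OreData R n) : Type _ := (Fin n →₀ ℕ) →₀ R

instance (D : OreData R n) : AddCommGroup D.Ext :=
  inferInstanceAs (AddCommGroup ((Fin n →₀ ℕ) →₀ R))

instance (D : OreData R n) : Module R D.Ext :=
  inferInstanceAs (Module R ((Fin n →₀ ℕ) →₀ R))

/-- The coefficients of an element of a multivariate Ore extension. -/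
def coeff (D : OreData R n) : D.Ext ≃ₗ[R] ((Fin n →₀ ℕ) →₀ R) := LinearEquiv.refl R _

/-- The element `r Y^a`. -/
def monomial (D : OreData R n) (a : Fin n →₀ ℕ) : R →+ D.Ext := Finsupp.singleAddHom a

theorem addHom_ext' (D : OreData R n) {N : Type*} [AddCommMonoid N] {f g : D.Ext →+ N}
    (h : ∀ a r, f (D.monomial a r) = g (D.monomial a r)) : f = g :=
  Finsupp.addHom_ext h

theorem smul_monomial (D : OreData R n) (r s : R) (a : Fin n →₀ ℕ) :
    r • D.monomial a s = D.monomial a (r * s) :=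
  Finsupp.smul_single' r a s

/-- Left multiplication by `Yᵢ`: `Yᵢ · (r Y^b) = αᵢ(r) Yᵢ Y^b + δᵢ(r) Y^b`. -/
def varMul (D : OreData R n) (i : Fin n) : AddMonoid.End D.Ext :=
  Finsupp.liftAddHom fun b =>
    (D.monomial (b + Finsupp.single i 1)).comp (D.α i : R →+ R) + (D.monomial b).comp (D.δ i)

theorem varMul_monomial (D : OreData R n) (i : Fin n) (b : Fin n →₀ ℕ) (r : R) :
    D.varMul i (D.monomial b r) =
      D.monomial (b + Finsupp.single i 1) (D.α i r) + D.monomial b (D.δ i r) :=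
  Finsupp.liftAddHom_apply_single _ _ _

theorem varMul_comm (D : OreData R n) (i j : Fin n) : Commute (D.varMul i) (D.varMul j) := by
  rcases eq_or_ne i j with rfl | hij
  · exact Commute.refl _
  refine D.addHom_ext' fun a r => ?_
  change D.varMul i (D.varMul j _) = D.varMul j (D.varMul i _)
  simp only [varMul_monomial, map_add, D.α_comm i j, D.δ_comm i j, D.α_δ_comm i j hij,
    D.α_δ_comm j i hij.symm, add_right_comm a (Finsupp.single j 1) (Finsupp.single i 1)]
  abel

theorem varMul_smul (D : OreData R n) (i : Fin n) (r : R) (f : D.Ext) :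
    D.varMul i (r • f) = D.α i r • D.varMul i f + D.δ i r • f := by
  have : (D.varMul i).comp (DistribSMul.toAddMonoidHom D.Ext r) =
      (DistribSMul.toAddMonoidHom D.Ext (D.α i r)).comp (D.varMul i) +
        DistribSMul.toAddMonoidHom D.Ext (D.δ i r) := by
    refine D.addHom_ext' fun a s => ?_
    change D.varMul i (r • D.monomial a s) =
      D.α i r • D.varMul i (D.monomial a s) + D.δ i r • D.monomial a s
    simp only [smul_monomial, varMul_monomial, smul_add, D.δ_mul, map_mul, map_add]
    abel
  exact DFunLike.congr_fun this f

theorem varMul_pow_comm (D : OreData R n) (s : Set (Fin n)) (a b : Fin n → ℕ) :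
    s.Pairwise fun i j => Commute (D.varMul i ^ a i) (D.varMul j ^ b j) :=
  fun i _ j _ _ => (D.varMul_comm i j).pow_pow (a i) (b j)

/-- Left multiplication by the term `Y^a = Y₁^{a₁} ⋯ Yₙ^{aₙ}`. -/
def termMul (D : OreData R n) (a : Fin n →₀ ℕ) : AddMonoid.End D.Ext :=
  univ.noncommProd (fun i => D.varMul i ^ a i) (D.varMul_pow_comm _ a a)

theorem termMul_zero (D : OreData R n) : D.termMul 0 = 1 := by
  unfold termMul
  exact (Finset.noncommProd_eq_pow_card _ _ _ 1 (by simp)).trans (one_pow _)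

theorem termMul_add (D : OreData R n) (a b : Fin n →₀ ℕ) :
    D.termMul (a + b) = D.termMul a * D.termMul b := by
  refine Eq.trans ?_ (Finset.noncommProd_mul_distrib (s := univ) (fun i => D.varMul i ^ a i)
    (fun i => D.varMul i ^ b i) (D.varMul_pow_comm _ a a) (D.varMul_pow_comm _ b b)
    (D.varMul_pow_comm _ b a))
  exact Finset.noncommProd_congr rfl (fun i _ => by simp [pow_add]) _

theorem termMul_single (D : OreData R n) (i : Fin n) :
    D.termMul (Finsupp.single i 1) = D.varMul i := by
  have h := Finset.noncommProd_insert_of_notMem (univ.erase i) i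
    (fun j => D.varMul j ^ (Finsupp.single i 1 : Fin n →₀ ℕ) j)
    (D.varMul_pow_comm _ _ _) (Finset.notMem_erase i univ)
  rw [Finset.noncommProd_eq_pow_card (univ.erase i) _ _ 1 (fun j hj => by
    simp [Finsupp.single_eq_of_ne (Finset.ne_of_mem_erase hj)]), one_pow, mul_one] at h
  refine (Finset.noncommProd_congr (Finset.insert_erase (Finset.mem_univ i)).symm
    (fun _ _ => rfl) _).trans (h.trans ?_)
  simp

/-- Left multiplication `(∑ r_a Y^a) ⋆ g = ∑ r_a (Y^a ⋆ g)`. -/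
def starHom (D : OreData R n) : D.Ext →+ AddMonoid.End D.Ext :=
  Finsupp.liftAddHom fun a =>
    (AddMonoidHom.mulRight (D.termMul a)).comp
      (Module.toAddMonoidEnd R D.Ext : R →+ AddMonoid.End D.Ext)

theorem starHom_monomial (D : OreData R n) (a : Fin n →₀ ℕ) (r : R) (g : D.Ext) :
    D.starHom (D.monomial a r) g = r • D.termMul a g := by
  unfold starHom monomial
  erw [Finsupp.liftAddHom_apply_single]
  rfl

instance (D : OreData R n) : Mul D.Ext := ⟨fun f g => D.starHom f g⟩

instance (D : OreData R n) : One D.Ext := ⟨D.monomial 0 1⟩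

theorem monomial_mul (D : OreData R n) (a : Fin n →₀ ℕ) (r : R) (g : D.Ext) :
    D.monomial a r * g = r • D.termMul a g :=
  D.starHom_monomial a r g

theorem termMul_one (D : OreData R n) (a : Fin n →₀ ℕ) (b : Fin n →₀ ℕ) :
    D.termMul a (D.monomial b 1) = D.monomial (a + b) 1 := by
  induction a using Finsupp.induction_linear generalizing b with
  | zero => simp [termMul_zero]
  | add f g hf hg =>
    rw [termMul_add]
    change D.termMul f (D.termMul g _) = _
    rw [hg, hf, add_assoc]
  | single i k =>
    induction k generalizing b with
    | zero => simp [termMul_zero]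
    | succ k ih =>
      rw [Finsupp.single_add, termMul_add]
      change D.termMul _ (D.termMul _ _) = _
      have h0 : D.δ i 1 = 0 := by simpa using D.δ_mul i 1 1
      rw [termMul_single, varMul_monomial, map_one, h0, map_zero, add_zero, ih,
        add_assoc, add_comm b]

theorem starHom_varMul (D : OreData R n) (i : Fin n) (f : D.Ext) :
    D.starHom (D.varMul i f) = D.varMul i * D.starHom f := by
  have : D.starHom.comp (D.varMul i) =
      (AddMonoidHom.mulLeft (D.varMul i)).comp D.starHom := by
    refine D.addHom_ext' fun a r => ?_
    refine AddMonoidHom.ext fun g => ?_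
    change D.starHom (D.varMul i _) g = D.varMul i (D.starHom _ g)
    rw [varMul_monomial, map_add]
    change D.starHom _ g + D.starHom _ g = _
    rw [starHom_monomial, starHom_monomial, starHom_monomial, varMul_smul, add_comm a, termMul_add, termMul_single]
    rfl
  exact DFunLike.congr_fun this f

theorem starHom_smul (D : OreData R n) (r : R) (f g : D.Ext) :
    D.starHom (r • f) g = r • D.starHom f g := by
  have : D.starHom.comp (Module.toAddMonoidEnd R D.Ext r) =
      (AddMonoidHom.mulLeft (Module.toAddMonoidEnd R D.Ext r)).comp D.starHom := by
    refine D.addHom_ext' fun a s => ?_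
    refine AddMonoidHom.ext fun g => ?_
    change D.starHom (r • D.monomial a s) g = r • D.starHom (D.monomial a s) g
    rw [smul_monomial, starHom_monomial, starHom_monomial, mul_smul]
  exact DFunLike.congr_fun (DFunLike.congr_fun this f) g

theorem starHom_termMul (D : OreData R n) (a : Fin n →₀ ℕ) (f : D.Ext) :
    D.starHom (D.termMul a f) = D.termMul a * D.starHom f := by
  induction a using Finsupp.induction_linear generalizing f with
  | zero => simp [termMul_zero]
  | add a b ha hb =>
    rw [termMul_add]
    change D.starHom (D.termMul a (D.termMul b f)) = _
    rw [ha, hb, mul_assoc]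
  | single i k =>
    induction k generalizing f with
    | zero => simp [termMul_zero]
    | succ k ih =>
      rw [Finsupp.single_add, termMul_add]
      change D.starHom (D.termMul _ (D.termMul _ f)) = _
      rw [ih, termMul_single, starHom_varMul, mul_assoc]

theorem starHom_starHom (D : OreData R n) (f g : D.Ext) :
    D.starHom (D.starHom f g) = D.starHom f * D.starHom g := by
  have : D.starHom.comp (AddMonoidHom.comp (AddMonoidHom.eval g) D.starHom) =
      (AddMonoidHom.mulRight (D.starHom g)).comp D.starHom := by
    refine D.addHom_ext' fun a s => ?_
    refine AddMonoidHom.ext fun h => ?_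
    change D.starHom (D.starHom (D.monomial a s) g) h =
      D.starHom (D.monomial a s) (D.starHom g h)
    rw [starHom_monomial, starHom_monomial, starHom_smul, starHom_termMul]
    rfl
  exact DFunLike.congr_fun this f

/-- The ring structure of the multivariate Ore extension, with multiplication `⋆`. -/
instance (D : OreData R n) : Ring D.Ext :=
  { (inferInstance : AddCommGroup D.Ext), (inferInstance : Mul D.Ext),
    (inferInstance : One D.Ext) with
    left_distrib := fun f g h => map_add (D.starHom f) g h
    right_distrib := fun f g h => DFunLike.congr_fun (map_add D.starHom f g) h
    zero_mul := fun f => DFunLike.congr_fun (map_zero D.starHom) f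
    mul_zero := fun f => map_zero (D.starHom f)
    mul_assoc := fun f g h => DFunLike.congr_fun (D.starHom_starHom f g) h
    one_mul := fun f => by
      change D.starHom (D.monomial 0 1) f = f
      rw [starHom_monomial, termMul_zero, one_smul]
      rfl
    mul_one := fun f => by
      have : (AddMonoidHom.eval (D.monomial 0 1)).comp D.starHom = AddMonoidHom.id D.Ext := by
        refine D.addHom_ext' fun a s => ?_
        change D.starHom (D.monomial a s) (D.monomial 0 1) = D.monomial a s
        rw [starHom_monomial, termMul_one, smul_monomial, add_zero, mul_one]
      exact DFunLike.congr_fun this f }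

/-- The variable `Yᵢ`. -/
def Y (D : OreData R n) (i : Fin n) : D.Ext := D.monomial (Finsupp.single i 1) 1

/-- The defining relation `Yᵢ ⋆ r = αᵢ(r) Yᵢ + δᵢ(r)`. -/
theorem Y_mul_C (D : OreData R n) (i : Fin n) (r : R) :
    D.Y i * D.monomial 0 r = D.α i r • D.Y i + D.monomial 0 (D.δ i r) := by
  rw [Y, monomial_mul, termMul_single, varMul_monomial, smul_monomial, one_smul, zero_add, mul_one]

/-- Terms multiply as in the commutative monoid of terms; in particular the variables commute. -/
theorem term_mul_term (D : OreData R n) (a b : Fin n →₀ ℕ) :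
    D.monomial a 1 * D.monomial b 1 = D.monomial (a + b) 1 := by
  rw [monomial_mul, termMul_one, one_smul]

/-- Left multiplication by a constant is the left `R`-module structure. -/
theorem C_mul (D : OreData R n) (r : R) (f : D.Ext) : D.monomial 0 r * f = r • f := by
  rw [monomial_mul, termMul_zero]
  rfl

/-- A multivariate Ore extension and its associated graded Ore extension coincide as left
`R`-modules (but not as rings). -/
def toGr (D : OreData R n) : D.Ext ≃ₗ[R] D.graded.Ext := LinearEquiv.refl R ((Fin n →₀ ℕ) →₀ R)

/-- The same identification for the free modules of vectors. -/
def toGrVec (D : OreData R n) (k : ℕ) : (Fin k → D.Ext) ≃ₗ[R] (Fin k → D.graded.Ext) :=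
  LinearEquiv.piCongrRight fun _ => D.toGr

end OreData

/-- The terms `Y^a e_i` of the free module of rank `m`. -/
@[ext]
structure Term (n m : ℕ) where
  exp : Fin n →₀ ℕ
  pos : Fin m

/-- The action `ω ∘ (Y^a e_i) = (ω Y^a) e_i` of terms of the ring on terms of the free module. -/
def Term.shift {n m : ℕ} (ω : Fin n →₀ ℕ) (t : Term n m) : Term n m := ⟨ω + t.exp, t.pos⟩

/-- A total ordering `<` on the terms of the free module of rank `m` is a term ordering compatible
with the term ordering `≺` on the terms of the ring. -/
structure IsCompatibleTermOrder {n : ℕ} (ord : MonomialOrder (Fin n)) (m : ℕ)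
    [LinearOrder (Term n m)] : Prop where
  wellFounded : WellFoundedLT (Term n m)
  shift_lt_shift : ∀ (ω : Fin n →₀ ℕ) (t₁ t₂ : Term n m),
    t₁ < t₂ → Term.shift ω t₁ < Term.shift ω t₂
  compatible : ∀ (ω₁ ω₂ : Fin n →₀ ℕ) (t : Term n m),
    ord.toSyn ω₁ < ord.toSyn ω₂ → Term.shift ω₁ t < Term.shift ω₂ t

namespace OreData

variable {R : Type*} [Ring R] {n : ℕ}

/-! ### Leading terms and leading monomials -/

/-- The exponent of the maximal term of a nonzero `l` with respect to `≺` (it is `0` for `l = 0`). -/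
def leadExp (D : OreData R n) (ord : MonomialOrder (Fin n)) (l : D.Ext) : Fin n →₀ ℕ :=
  ord.toSyn.symm ((D.coeff l).support.sup ord.toSyn)

/-- The maximal monomial of `l` with respect to `≺` (it is `0` for `l = 0`). -/
def leadMon (D : OreData R n) (ord : MonomialOrder (Fin n)) (l : D.Ext) : D.Ext :=
  D.monomial (D.leadExp ord l) (D.coeff l (D.leadExp ord l))

/-- The monomial `c t` of the free module of rank `m`. -/
def vecMonomial (D : OreData R n) {m : ℕ} (c : R) (t : Term n m) : Fin m → D.Ext :=
  Pi.single t.pos (D.monomial t.exp c)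

/-- The set of all monomials `c t`, `c ≠ 0`, of the free module of rank `m`. -/
def monomials (D : OreData R n) (m : ℕ) : Set (Fin m → D.Ext) :=
  {f | ∃ (c : R) (t : Term n m), c ≠ 0 ∧ f = D.vecMonomial c t}

section Order

variable (D : OreData R n) {m : ℕ} [LinearOrder (Term n m)]

/-- The maximal term `T(f)`, with `T(0) = ⊥`. -/
def leadTerm (f : Fin m → D.Ext) : WithBot (Term n m) :=
  univ.sup fun i => (D.coeff (f i)).support.sup fun a => ((⟨a, i⟩ : Term n m) : WithBot (Term n m))

/-- The maximal monomial `M(f) = lc(f) T(f)`, with `M(0) = 0`. -/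
def leadMonomial (f : Fin m → D.Ext) : Fin m → D.Ext :=
  WithBot.recBotCoe 0 (fun t => D.vecMonomial (D.coeff (f t.pos) t.exp) t) (D.leadTerm f)

/-- `M{F} = {M(f) : f ∈ F, f ≠ 0}`. -/
def leadMonomials (F : Set (Fin m → D.Ext)) : Set (Fin m → D.Ext) :=
  {h | ∃ f ∈ F, f ≠ 0 ∧ h = D.leadMonomial f}

/-- `M_L(F) = {M(aλ ⋆ f) : a ∈ R \ {0}, λ a term, f ∈ F, f ≠ 0}`. -/
def leadMonomialsLeft (F : Set (Fin m → D.Ext)) : Set (Fin m → D.Ext) :=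
  {h | ∃ (a : R) (w : Fin n →₀ ℕ), a ≠ 0 ∧
    ∃ f ∈ F, f ≠ 0 ∧ h = D.leadMonomial (D.monomial w a • f)}

/-- `I_L(M{G})`: the left module generated by the maximal monomials of `G` in the free module over
the associated graded Ore extension. -/
def leadModule (G : Set (Fin m → D.Ext)) : Submodule D.graded.Ext (Fin m → D.graded.Ext) :=
  Submodule.span D.graded.Ext (D.toGrVec m '' D.leadMonomials G)

/-- `G` is a left (weak) Gröbner basis of the left module `I`: `G ⊆ I` and
`M{I} = M_L(I) = M{I_L(M{G})} = I_L(M{G}) ∩ {monomials}`. -/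
def IsLeftGroebnerBasis (I : Submodule D.Ext (Fin m → D.Ext)) (G : Set (Fin m → D.Ext)) : Prop :=
  G ⊆ I ∧
  D.leadMonomials (I : Set (Fin m → D.Ext)) = D.leadMonomialsLeft (I : Set (Fin m → D.Ext)) ∧
  D.toGrVec m '' D.leadMonomials (I : Set (Fin m → D.Ext)) =
    D.graded.leadMonomials (D.leadModule G : Set (Fin m → D.graded.Ext)) ∧
  D.graded.leadMonomials (D.leadModule G : Set (Fin m → D.graded.Ext)) =
    (D.leadModule G : Set (Fin m → D.graded.Ext)) ∩ D.graded.monomials m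

variable (ord : MonomialOrder (Fin n)) {u : ℕ} (g : Fin u → Fin m → D.Ext)

/-- `f` has a left Gröbner representation `f = ∑ lᵢ ⋆ gᵢ` with `T(lᵢ) ∘ T(gᵢ) ≤ T(f)` for each `i`
(the condition is void where `lᵢ = 0`). -/
def HasLeftGroebnerRep (f : Fin m → D.Ext) : Prop :=
  ∃ l : Fin u → D.Ext, f = ∑ i, l i • g i ∧
    ∀ i, l i ≠ 0 → (D.leadTerm (g i)).map (Term.shift (D.leadExp ord (l i))) ≤ D.leadTerm f

/-- The morphism `𝔖_L : (hᵢ) ↦ ∑ hᵢ ⋆ gᵢ` over the Ore extension. -/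
def bigS : (Fin u → D.Ext) →ₗ[D.Ext] (Fin m → D.Ext) :=
  Fintype.linearCombination D.Ext g

/-- The morphism `𝔰_L : (hᵢ) ↦ ∑ hᵢ ∗ M(gᵢ)` over the associated graded Ore extension. -/
def smallS : (Fin u → D.graded.Ext) →ₗ[D.graded.Ext] (Fin m → D.graded.Ext) :=
  Fintype.linearCombination D.graded.Ext fun i => D.toGrVec m (D.leadMonomial (g i))

/-- The valuation `v(σ) = max T(hᵢ ⋆ gᵢ)` of `σ = (hᵢ)`, with `v(0) = ⊥`. -/
def val (σ : Fin u → D.Ext) : WithBot (Term n m) :=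
  univ.sup fun i => D.leadTerm (σ i • g i)

open Classical in
/-- The leading form `𝓛_L(σ) = ∑_{i ∈ H} M(hᵢ) eᵢ` where `H = {i : T(hᵢ ⋆ gᵢ) = v(σ)}`. -/
def leadForm (σ : Fin u → D.Ext) : Fin u → D.graded.Ext := fun i =>
  if D.leadTerm (σ i • g i) = D.val g σ then D.toGr (D.leadMon ord (σ i)) else 0

/-- `σ = (hᵢ)` is homogeneous of degree `t`: every term `ω` of `hᵢ` satisfies `ω ∘ T(gᵢ) = t`. -/
def IsHomogeneousOfDegree (t : Term n m) (σ : Fin u → D.graded.Ext) : Prop :=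
  ∀ i, ∀ w ∈ (D.graded.coeff (σ i)).support, (D.leadTerm (g i)).map (Term.shift w) = t

/-- `σ` is homogeneous. -/
def IsHomogeneous (σ : Fin u → D.graded.Ext) : Prop :=
  ∃ t : Term n m, D.IsHomogeneousOfDegree g t σ

/-- A left Gebauer–Möller set: a set of homogeneous elements that generates `ker 𝔰_L`. -/
def IsGebauerMoellerSet (B : Set (Fin u → D.graded.Ext)) : Prop :=
  (∀ σ ∈ B, D.IsHomogeneous g σ) ∧ Submodule.span D.graded.Ext B = LinearMap.ker (D.smallS g)

/-- `𝔖_L(σ)` has a left quasi-Gröbner representation `∑ lᵢ ⋆ gᵢ` with `T(lᵢ ⋆ gᵢ) < v(σ)` for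
each `i` (the condition is void where `lᵢ = 0`). -/
def HasLeftQuasiGroebnerRep (σ : Fin u → D.Ext) : Prop :=
  ∃ l : Fin u → D.Ext, D.bigS g σ = ∑ i, l i • g i ∧
    ∀ i, l i ≠ 0 → D.leadTerm (l i • g i) < D.val g σ

/-- `σ` has a lifting: some `U ∈ ker 𝔖_L` with `𝓛_L(U) = σ`. -/
def HasLifting (σ : Fin u → D.graded.Ext) : Prop :=
  ∃ U : Fin u → D.Ext, U ∈ LinearMap.ker (D.bigS g) ∧ D.leadForm ord g U = σ

end Order

end OreData

end

noncomputable section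

/-! ### Shifts of terms and their interaction with the term orderings. -/

namespace Term

variable {n m : ℕ}

/-! Everything is a comparison of top-degree parts. Give the `i`-th basis vector of the syzygy side
the degree `T(gᵢ)`. `IsForm wt t f f'` says that `f` lives in weights at most `t` and that `f'` is
its part of weight exactly `t`, possibly zero. Unlike taking leading monomials, this relation is
additive. It is also stable under multiplication by monomials (`IsForm.monomial_smul`): the
derivation part of `Yᵢ ⋆ r` stays at the old term, strictly below the shifted one. Hence
`IsForm.bigS`: if `L'` is the form of `L`, then `𝔰_L(L')` is the form of `𝔖_L(L)`.

Since `R` is a domain and the `αᵢ` are injective, `T(l ⋆ g) = T(l) ∘ T(g)` (`leadTerm_smul`). So for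
`L ≠ 0` the value `v(L)` is the largest weight in `L`, and the leading form of `L` is its part of
that weight. A Gröbner representation of `f` is then an `L` with `𝔖_L(L) = f` and `v(L) ≤ T(f)`.

What remains is cancellation of top parts. If `M(f) ∈ N`, subtract from `f` a combination with the
same form and recurse on `T(f)`; conversely, given a representation `L` of `f`, `M(f)` is `𝔰_L` of
the part of `L` of weight `T(f)`. For a nonzero homogeneous syzygy `σ`, the form of `𝔖_L(σ)`
vanishes, so it drops below `v(σ)`; representing it by `L` yields the lifting `σ - L`. Liftings pass
from generators to all homogeneous syzygies, because being the form of an element of `ker 𝔖_L`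
survives sums and monomial multiples (`homogPart_span_induction`). Finally, if `v(L) > T(f)`, the
leading form of `L` is a syzygy, and subtracting a lifting of it lowers `v(L)`; well-ordering ends
the process. -/

theorem shift_add (v w : Fin n →₀ ℕ) (t : Term n m) : shift (v + w) t = shift v (shift w t) := by
  simp [shift, add_assoc]

theorem shift_zero (t : Term n m) : shift 0 t = t := by simp [shift]

theorem shift_injective (w : Fin n →₀ ℕ) : Function.Injective (shift w : Term n m → Term n m) := by
  rintro ⟨a, i⟩ ⟨b, j⟩ h
  simpa [shift] using h

theorem shift_left_injective (t : Term n m) : Function.Injective fun w => shift w t := by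
  intro v w h
  simpa [shift] using h

theorem exists_eq_shift_single (i : Fin n) (s : Term n m) (hs : s.exp i ≠ 0) :
    ∃ s' : Term n m, s = s'.shift (Finsupp.single i 1) :=
  ⟨⟨s.exp - Finsupp.single i 1, s.pos⟩, by
    ext1
    · exact (add_tsub_cancel_of_le (by simpa [Nat.one_le_iff_ne_zero] using hs)).symm
    · rfl⟩

end Term

namespace IsCompatibleTermOrder

variable {n m : ℕ} {ord : MonomialOrder (Fin n)} [LinearOrder (Term n m)]

theorem strictMono_shift (hord : IsCompatibleTermOrder ord m) (w : Fin n →₀ ℕ) :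
    StrictMono (Term.shift w : Term n m → Term n m) :=
  fun _ _ h => hord.shift_lt_shift w _ _ h

theorem shift_le_shift_iff (hord : IsCompatibleTermOrder ord m) {v w : Fin n →₀ ℕ}
    {t : Term n m} : Term.shift v t ≤ Term.shift w t ↔ ord.toSyn v ≤ ord.toSyn w := by
  refine ⟨fun h => not_lt.1 fun h' => (hord.compatible _ _ t h').not_ge h, fun h => ?_⟩
  rcases h.lt_or_eq with h | h
  · exact (hord.compatible _ _ t h).le
  · rw [ord.toSyn.injective h]

/-- This strictness is what makes derivations invisible in top degree: `Yᵢ ⋆ (r t)` has its `δᵢ(r)`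
at `t`, below the term carrying `αᵢ(r)`. -/
theorem lt_shift_single (hord : IsCompatibleTermOrder ord m) (i : Fin n) (t : Term n m) :
    t < Term.shift (Finsupp.single i 1) t := by
  have h := hord.compatible 0 (Finsupp.single i 1) t (by
    rw [map_zero]
    exact (ord.zero_le _).lt_of_ne fun h => by
      have := ord.toSyn.injective ((map_zero ord.toSyn).trans h)
      simpa using DFunLike.congr_fun this i)
  rwa [Term.shift_zero] at h

end IsCompatibleTermOrder

/-! ### Coefficients, and multiplication by one variable. -/

namespace OreData

variable {R : Type*} [Ring R] {n : ℕ}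

theorem coeff_monomial (D : OreData R n) (a b : Fin n →₀ ℕ) (r : R) :
    D.coeff (D.monomial a r) b = if a = b then r else 0 := by
  classical
  exact Finsupp.single_apply

theorem ext_of_coeff (D : OreData R n) {x y : D.Ext} (h : ∀ b, D.coeff x b = D.coeff y b) :
    x = y :=
  D.coeff.injective (Finsupp.ext h)

theorem coeff_toGr (D : OreData R n) (x : D.Ext) (b : Fin n →₀ ℕ) :
    D.graded.coeff (D.toGr x) b = D.coeff x b := rfl

theorem monomial_eq_mul (D : OreData R n) (a : Fin n →₀ ℕ) (r : R) :
    D.monomial a r = D.monomial 0 r * D.monomial a 1 := by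
  rw [C_mul, smul_monomial, mul_one]

/-- Every element is the sum of its monomials. -/
theorem sum_monomial (D : OreData R n) (x : D.Ext) :
    ∑ w ∈ (D.coeff x).support, D.monomial w (D.coeff x w) = x :=
  Finsupp.sum_single (D.coeff x)

theorem monomial_induction (D : OreData R n) {P : D.Ext → Prop} (x : D.Ext) (zero : P 0)
    (add : ∀ x y, P x → P y → P (x + y)) (monomial : ∀ w r, P (D.monomial w r)) : P x := by
  rw [← D.sum_monomial x]
  exact Finset.sum_induction _ P add zero fun w _ => monomial w _

theorem coeff_varMul_add (D : OreData R n) (i : Fin n) (x : D.Ext) (b : Fin n →₀ ℕ) :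
    D.coeff (D.varMul i x) (b + Finsupp.single i 1) =
      D.α i (D.coeff x b) + D.δ i (D.coeff x (b + Finsupp.single i 1)) := by
  induction x using D.monomial_induction with
  | zero => simp
  | add x y hx hy => simp only [map_add, Finsupp.add_apply, hx, hy]; abel
  | monomial w r =>
    simp only [varMul_monomial, map_add, Finsupp.add_apply, coeff_monomial, add_left_inj]
    split_ifs <;> simp

theorem coeff_varMul_of_eq_zero (D : OreData R n) (i : Fin n) (x : D.Ext) (b : Fin n →₀ ℕ)
    (hb : b i = 0) : D.coeff (D.varMul i x) b = D.δ i (D.coeff x b) := by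
  induction x using D.monomial_induction with
  | zero => simp
  | add x y hx hy => simp only [map_add, Finsupp.add_apply, hx, hy]
  | monomial w r =>
    have : w + Finsupp.single i 1 ≠ b := fun h => by simp [← h] at hb
    simp only [varMul_monomial, map_add, Finsupp.add_apply, coeff_monomial, this, if_false, zero_add]
    split_ifs <;> simp

/-- The coefficient of a vector at a term of the free module. -/
def vecCoeff (D : OreData R n) {k : ℕ} (s : Term n k) : (Fin k → D.Ext) →ₗ[R] R :=
  Finsupp.lapply s.exp ∘ₗ D.coeff.toLinearMap ∘ₗ LinearMap.proj s.pos

section Vec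

variable (D : OreData R n) {k : ℕ}

theorem vecCoeff_apply (s : Term n k) (f : Fin k → D.Ext) :
    D.vecCoeff s f = D.coeff (f s.pos) s.exp := rfl

theorem vec_ext {f f' : Fin k → D.Ext} (h : ∀ s, D.vecCoeff s f = D.vecCoeff s f') : f = f' :=
  funext fun i => D.ext_of_coeff fun b => h ⟨b, i⟩

theorem exists_vecCoeff_ne_zero {f : Fin k → D.Ext} (hf : f ≠ 0) : ∃ s, D.vecCoeff s f ≠ 0 := by
  by_contra! h
  exact hf (D.vec_ext fun s => by rw [h, map_zero])

theorem vecCoeff_toGrVec (s : Term n k) (f : Fin k → D.Ext) :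
    D.graded.vecCoeff s (D.toGrVec k f) = D.vecCoeff s f := rfl

theorem vecCoeff_vecMonomial (s t : Term n k) [Decidable (t = s)] (c : R) :
    D.vecCoeff s (D.vecMonomial c t) = if t = s then c else 0 := by
  obtain ⟨a, i⟩ := s
  obtain ⟨b, j⟩ := t
  rw [vecCoeff_apply, vecMonomial]
  by_cases h : j = i
  · subst h
    simp [coeff_monomial]
  · simp [h]

theorem vecCoeff_C_smul (s : Term n k) (r : R) (f : Fin k → D.Ext) :
    D.vecCoeff s (D.monomial 0 r • f) = r * D.vecCoeff s f := by
  simp only [vecCoeff_apply, Pi.smul_apply, smul_eq_mul, C_mul, map_smul, Finsupp.smul_apply]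

theorem vecCoeff_Y_smul_shift (i : Fin n) (s : Term n k) (f : Fin k → D.Ext) :
    D.vecCoeff (s.shift (Finsupp.single i 1)) (D.Y i • f) =
      D.α i (D.vecCoeff s f) + D.δ i (D.vecCoeff (s.shift (Finsupp.single i 1)) f) := by
  simp only [vecCoeff_apply, Pi.smul_apply, smul_eq_mul, Y, monomial_mul, termMul_single, one_smul,
    Term.shift, add_comm (Finsupp.single i 1), coeff_varMul_add]

theorem vecCoeff_Y_smul_of_eq_zero (i : Fin n) (s : Term n k) (hs : s.exp i = 0)
    (f : Fin k → D.Ext) : D.vecCoeff s (D.Y i • f) = D.δ i (D.vecCoeff s f) := by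
  simp only [vecCoeff_apply, Pi.smul_apply, smul_eq_mul, Y, monomial_mul, termMul_single, one_smul,
    coeff_varMul_of_eq_zero _ _ _ _ hs]

end Vec

/-- A relation between vectors over two Ore extensions, indexed by terms, that is stable under the
variables is stable under terms. -/
theorem term_smul_induction {m : ℕ} {D D' : OreData R n} {V V' : Type*}
    [AddCommGroup V] [Module D.Ext V] [AddCommGroup V'] [Module D'.Ext V']
    {P : Term n m → V → V' → Prop}
    (hY : ∀ i t x y, P t x y → P (t.shift (Finsupp.single i 1)) (D.Y i • x) (D'.Y i • y))
    (w : Fin n →₀ ℕ) (t : Term n m) (x : V) (y : V') (h : P t x y) :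
    P (t.shift w) (D.monomial w 1 • x) (D'.monomial w 1 • y) := by
  have h1 : ∀ D : OreData R n, D.monomial 0 1 = 1 := fun _ => rfl
  induction w using Finsupp.induction_linear generalizing t x y with
  | zero => rwa [Term.shift_zero, h1, h1, one_smul, one_smul]
  | add v w hv hw =>
    rw [← term_mul_term, mul_smul, ← term_mul_term, mul_smul, Term.shift_add]
    exact hv _ _ _ (hw _ _ _ h)
  | single i j =>
    induction j with
    | zero => rwa [Finsupp.single_zero, Term.shift_zero, h1, h1, one_smul, one_smul]
    | succ j ih =>
      -- The additional variable is moved to the left so that it acts last, as `hY` requires.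
      rw [add_comm, Finsupp.single_add, ← term_mul_term, ← term_mul_term, mul_smul, mul_smul,
        Term.shift_add]
      exact hY _ _ _ _ ih

/-- A relation that is stable under scalars and variables is stable under monomials. -/
theorem monomial_smul_induction {m : ℕ} {D D' : OreData R n} {V V' : Type*}
    [AddCommGroup V] [Module D.Ext V] [AddCommGroup V'] [Module D'.Ext V']
    {P : Term n m → V → V' → Prop}
    (hC : ∀ r t x y, P t x y → P t (D.monomial 0 r • x) (D'.monomial 0 r • y))
    (hY : ∀ i t x y, P t x y → P (t.shift (Finsupp.single i 1)) (D.Y i • x) (D'.Y i • y))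
    (w : Fin n →₀ ℕ) (r : R) (t : Term n m) (x : V) (y : V') (h : P t x y) :
    P (t.shift w) (D.monomial w r • x) (D'.monomial w r • y) := by
  rw [monomial_eq_mul, D'.monomial_eq_mul, mul_smul, mul_smul]
  exact hC _ _ _ _ (term_smul_induction hY w t x y h)

/-! ### Homogeneous parts over the graded extension. -/

section Graded

variable {k m : ℕ} (D : OreData R n)

/-- The part of degree `t` of a vector over the associated graded Ore extension, where the term `s`
has degree `wt s`. -/
def homogPart (wt : Term n k → Term n m) (t : Term n m) (h : Fin k → D.Ext) : Fin k → D.Ext :=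
  open Classical in
  fun i => D.coeff.symm ((D.coeff (h i)).filter fun w => wt ⟨w, i⟩ = t)

variable {wt : Term n k → Term n m}

open Classical in
theorem vecCoeff_homogPart (t : Term n m) (h : Fin k → D.Ext) (s : Term n k) :
    D.vecCoeff s (D.homogPart wt t h) = if wt s = t then D.vecCoeff s h else 0 := by
  simp only [vecCoeff_apply, homogPart, LinearEquiv.apply_symm_apply, Finsupp.filter_apply]

theorem homogPart_zero (t : Term n m) : D.homogPart wt t (0 : Fin k → D.Ext) = 0 :=
  D.vec_ext fun s => by simp [vecCoeff_homogPart]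

theorem homogPart_add (t : Term n m) (h h' : Fin k → D.Ext) :
    D.homogPart wt t (h + h') = D.homogPart wt t h + D.homogPart wt t h' :=
  D.vec_ext fun s => by
    simp only [vecCoeff_homogPart, map_add]
    split_ifs <;> simp

theorem homogPart_eq_self {t : Term n m} {h : Fin k → D.Ext}
    (hh : ∀ s, D.vecCoeff s h ≠ 0 → wt s = t) : D.homogPart wt t h = h :=
  D.vec_ext fun s => by
    rw [vecCoeff_homogPart]
    split_ifs with hs
    · rfl
    · by_contra h0
      exact hs (hh s (Ne.symm h0))

theorem homogPart_eq_zero {t t' : Term n m} (htt' : t' ≠ t) {h : Fin k → D.Ext}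
    (hh : ∀ s, D.vecCoeff s h ≠ 0 → wt s = t) : D.homogPart wt t' h = 0 :=
  D.vec_ext fun s => by
    rw [vecCoeff_homogPart, map_zero]
    split_ifs with hs
    · by_contra h0
      exact htt' (hs.symm.trans (hh s h0))
    · rfl

theorem graded_vecCoeff_Y_smul_shift (i : Fin n) (s : Term n k) (f : Fin k → D.graded.Ext) :
    D.graded.vecCoeff (s.shift (Finsupp.single i 1)) (D.graded.Y i • f) =
      D.α i (D.graded.vecCoeff s f) := by
  rw [vecCoeff_Y_smul_shift]
  exact add_zero _

theorem graded_vecCoeff_Y_smul_of_eq_zero (i : Fin n) (s : Term n k) (hs : s.exp i = 0)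
    (f : Fin k → D.graded.Ext) : D.graded.vecCoeff s (D.graded.Y i • f) = 0 := by
  rw [vecCoeff_Y_smul_of_eq_zero _ _ _ hs]
  rfl

/-- Without derivations, multiplying by `r Y^w` moves every term by exactly `w`, so degrees rise
uniformly. Injectivity of the shift ensures that no other degree contributes. -/
theorem homogPart_monomial_smul (hwt : ∀ w s, wt (s.shift w) = (wt s).shift w)
    (w : Fin n →₀ ℕ) (r : R) (t : Term n m) (h : Fin k → D.graded.Ext) :
    D.graded.homogPart wt (t.shift w) (D.graded.monomial w r • h) =
      D.graded.monomial w r • D.graded.homogPart wt t h := by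
  refine monomial_smul_induction (D := D.graded) (D' := D.graded)
    (P := fun t (x y : Fin k → D.graded.Ext) => D.graded.homogPart wt t x = y)
    (fun r t x y hxy => ?_) (fun i t x y hxy => ?_) w r t h _ rfl
  · subst hxy
    refine D.graded.vec_ext fun s => ?_
    simp only [vecCoeff_homogPart, vecCoeff_C_smul, mul_ite, mul_zero]
  · subst hxy
    refine D.graded.vec_ext fun s => ?_
    by_cases hs : s.exp i = 0
    · simp only [vecCoeff_homogPart, D.graded_vecCoeff_Y_smul_of_eq_zero i s hs, ite_self]
    · obtain ⟨s, rfl⟩ := s.exists_eq_shift_single i hs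
      have hst : wt (s.shift (Finsupp.single i 1)) = t.shift (Finsupp.single i 1) ↔ wt s = t := by
        rw [hwt, (Term.shift_injective _).eq_iff]
      rw [vecCoeff_homogPart, graded_vecCoeff_Y_smul_shift, graded_vecCoeff_Y_smul_shift,
        vecCoeff_homogPart, apply_ite (D.α i), map_zero]
      split_ifs <;> tauto

/-- Complements `homogPart_monomial_smul`: in degrees that are not shifts by `w`, the homogeneous
part of a multiple by `r Y^w` vanishes. -/
theorem exists_eq_shift_of_vecCoeff_monomial_smul_ne_zero (w : Fin n →₀ ℕ) (r : R)
    (h : Fin k → D.graded.Ext) (s : Term n k)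
    (hs : D.graded.vecCoeff s (D.graded.monomial w r • h) ≠ 0) : ∃ s' : Term n k, s = s'.shift w := by
  have key := monomial_smul_induction (D := D.graded) (D' := D.graded)
    (P := fun (t : Term n 1) (x _ : Fin k → D.graded.Ext) =>
      ∀ s, D.graded.vecCoeff s x ≠ 0 → t.exp ≤ s.exp)
    (fun r t x _ hx s hs => hx s fun h0 => hs (by rw [vecCoeff_C_smul, h0, mul_zero]))
    (fun i t x _ hx s hs => by
      by_cases h0 : s.exp i = 0
      · exact absurd (D.graded_vecCoeff_Y_smul_of_eq_zero i s h0 x) hs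
      · obtain ⟨s, rfl⟩ := s.exists_eq_shift_single i h0
        rw [graded_vecCoeff_Y_smul_shift] at hs
        exact add_le_add_right (hx s fun h0 => hs (by rw [h0, map_zero])) _)
    -- The index is a dummy term of rank one: starting at exponent `0`, it merely records the
    -- accumulated exponent `w`.
    w r ⟨0, 0⟩ h h (fun s _ => bot_le) s hs
  refine ⟨⟨s.exp - w, s.pos⟩, ?_⟩
  ext1
  · exact (add_tsub_cancel_of_le (by simpa [Term.shift] using key)).symm
  · rfl

/-- A property of homogeneous vectors that is stable under sums and multiplication by monomials
holds for the homogeneous parts of all elements of a submodule if it holds for the homogeneous parts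
of its generators. -/
theorem homogPart_span_induction (hwt : ∀ w s, wt (s.shift w) = (wt s).shift w)
    {B : Set (Fin k → D.graded.Ext)} {P : Term n m → (Fin k → D.graded.Ext) → Prop}
    (zero : ∀ t, P t 0) (add : ∀ t x y, P t x → P t y → P t (x + y))
    (monomial_smul : ∀ w r t x, P t x → P (t.shift w) (D.graded.monomial w r • x))
    (mem : ∀ b ∈ B, ∀ t, P t (D.graded.homogPart wt t b))
    {h : Fin k → D.graded.Ext} (hh : h ∈ Submodule.span D.graded.Ext B) (t : Term n m) :
    P t (D.graded.homogPart wt t h) := by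
  induction hh using Submodule.span_induction generalizing t with
  | mem b hb => exact mem b hb t
  | zero => rw [homogPart_zero]; exact zero t
  | add x y _ _ hx hy => rw [homogPart_add]; exact add _ _ _ (hx t) (hy t)
  | smul a x _ hx =>
    induction a using D.graded.monomial_induction generalizing t with
    | zero => rw [zero_smul, homogPart_zero]; exact zero t
    | add a b ha hb => rw [add_smul, homogPart_add]; exact add _ _ _ (ha t) (hb t)
    | monomial w r =>
      by_cases ht : ∃ t' : Term n m, t = t'.shift w
      · obtain ⟨t, rfl⟩ := ht
        rw [homogPart_monomial_smul _ hwt]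
        exact monomial_smul _ _ _ _ (hx t)
      · have : D.graded.homogPart wt t (D.graded.monomial w r • x) = 0 := by
          refine D.graded.vec_ext fun s => ?_
          rw [vecCoeff_homogPart, map_zero]
          split_ifs with hs
          · by_contra h0
            obtain ⟨s, rfl⟩ := D.exists_eq_shift_of_vecCoeff_monomial_smul_ne_zero w r x s h0
            exact ht ⟨wt s, by rw [← hs, hwt]⟩
          · rfl
        rw [this]
        exact zero t

end Graded

/-! ### Forms: top-weight parts of vectors over the Ore extension. -/

section Form

variable {k m : ℕ} (D : OreData R n) [LinearOrder (Term n m)]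

/-- All terms of `f` have weight at most `t`, and `f'` is the part of weight `t` of `f`. -/
structure IsForm (wt : Term n k → Term n m) (t : Term n m) (f : Fin k → D.Ext)
    (f' : Fin k → D.graded.Ext) : Prop where
  eq_zero : ∀ s, t < wt s → D.vecCoeff s f = 0
  eq : ∀ s, wt s = t → D.vecCoeff s f = D.graded.vecCoeff s f'
  homog : ∀ s, wt s ≠ t → D.graded.vecCoeff s f' = 0

variable {D} {wt : Term n k → Term n m} {t : Term n m} {f f₁ f₂ : Fin k → D.Ext}
  {f' f₁' f₂' : Fin k → D.graded.Ext}

theorem isForm_zero (wt : Term n k → Term n m) (t : Term n m) : D.IsForm wt t 0 0 := by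
  constructor <;> intros <;> simp

theorem isForm_homogPart (h : ∀ s, t < wt s → D.vecCoeff s f = 0) :
    D.IsForm wt t f (D.graded.homogPart wt t (D.toGrVec k f)) where
  eq_zero := h
  eq s hs := by rw [vecCoeff_homogPart, if_pos hs, vecCoeff_toGrVec]
  homog s hs := by rw [vecCoeff_homogPart, if_neg hs]

theorem isForm_toGrVec_symm (h : ∀ s, D.graded.vecCoeff s f' ≠ 0 → wt s = t) :
    D.IsForm wt t ((D.toGrVec k).symm f') f' where
  eq_zero s hs := by
    by_contra h0
    exact hs.ne' (h s h0)
  eq s _ := rfl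
  homog s hs := by
    by_contra h0
    exact hs (h s h0)

namespace IsForm

theorem add (h₁ : D.IsForm wt t f₁ f₁') (h₂ : D.IsForm wt t f₂ f₂') :
    D.IsForm wt t (f₁ + f₂) (f₁' + f₂') where
  eq_zero s hs := by rw [map_add, h₁.eq_zero s hs, h₂.eq_zero s hs, add_zero]
  eq s hs := by rw [map_add, map_add, h₁.eq s hs, h₂.eq s hs]
  homog s hs := by rw [map_add, h₁.homog s hs, h₂.homog s hs, add_zero]

theorem sub (h₁ : D.IsForm wt t f₁ f₁') (h₂ : D.IsForm wt t f₂ f₂') :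
    D.IsForm wt t (f₁ - f₂) (f₁' - f₂') where
  eq_zero s hs := by rw [map_sub, h₁.eq_zero s hs, h₂.eq_zero s hs, sub_zero]
  eq s hs := by rw [map_sub, map_sub, h₁.eq s hs, h₂.eq s hs]
  homog s hs := by rw [map_sub, h₁.homog s hs, h₂.homog s hs, sub_zero]

theorem sum {ι : Type*} (S : Finset ι) {F : ι → Fin k → D.Ext} {F' : ι → Fin k → D.graded.Ext}
    (h : ∀ i ∈ S, D.IsForm wt t (F i) (F' i)) :
    D.IsForm wt t (∑ i ∈ S, F i) (∑ i ∈ S, F' i) := by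
  classical
  induction S using Finset.induction_on with
  | empty => exact isForm_zero wt t
  | insert i S hi ih =>
    rw [Finset.sum_insert hi, Finset.sum_insert hi]
    exact (h i (Finset.mem_insert_self i S)).add (ih fun j hj => h j (Finset.mem_insert_of_mem hj))

/-- Forms are unique. Two forms of the same vector in the same degree can thus be identified, the
main way equations over the graded ring are obtained. -/
theorem eq_homogPart (h : D.IsForm wt t f f') :
    f' = D.graded.homogPart wt t (D.toGrVec k f) :=
  D.graded.vec_ext fun s => by
    rw [vecCoeff_homogPart, vecCoeff_toGrVec]
    split_ifs with hs
    · exact (h.eq s hs).symm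
    · exact h.homog s hs

theorem zero_of_lt (h : D.IsForm wt t f f') {t' : Term n m} (ht : t < t') :
    D.IsForm wt t' f 0 where
  eq_zero s hs := h.eq_zero s (ht.trans hs)
  eq s hs := by rw [h.eq_zero s (ht.trans_eq hs.symm), map_zero]
  homog s _ := map_zero _

theorem lt_of_ne_zero (h : D.IsForm wt t f 0) {s : Term n k} (hs : D.vecCoeff s f ≠ 0) :
    wt s < t := by
  rcases lt_trichotomy (wt s) t with h' | h' | h'
  · exact h'
  · exact absurd ((h.eq s h').trans (map_zero _)) hs
  · exact absurd (h.eq_zero s h') hs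

theorem zero_of_forall_lt (h : ∀ s, D.vecCoeff s f ≠ 0 → wt s < t) : D.IsForm wt t f 0 where
  eq_zero s hs := by
    by_contra h0
    exact (h s h0).not_gt hs
  eq s hs := by
    by_contra h0
    exact (h s (by rwa [map_zero] at h0)).ne hs
  homog s _ := map_zero _

variable {ord : MonomialOrder (Fin n)}

/-- The coefficient of `Yᵢ • f` at a shifted term is an `αᵢ`-part plus a `δᵢ`-part. At weights at
least that of the shifted `t`, the latter involves a coefficient of `f` of weight above `t`, hence
zero; only the graded multiplication survives. -/
theorem Y_smul (hord : IsCompatibleTermOrder ord m)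
    (hwt : ∀ w s, wt (s.shift w) = (wt s).shift w) (i : Fin n) (h : D.IsForm wt t f f') :
    D.IsForm wt (t.shift (Finsupp.single i 1)) (D.Y i • f) (D.graded.Y i • f') := by
  have hmono := hord.strictMono_shift (Finsupp.single i 1)
  have hlt := hord.lt_shift_single i t
  refine ⟨fun s hs => ?_, fun s hs => ?_, fun s hs => ?_⟩
  · by_cases h0 : s.exp i = 0
    · rw [vecCoeff_Y_smul_of_eq_zero _ _ _ h0, h.eq_zero s (hlt.trans hs), map_zero]
    · obtain ⟨s, rfl⟩ := s.exists_eq_shift_single i h0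
      rw [vecCoeff_Y_smul_shift, h.eq_zero (s.shift _) (hlt.trans hs)]
      rw [hwt, hmono.lt_iff_lt] at hs
      rw [h.eq_zero s hs, map_zero, map_zero, add_zero]
  · by_cases h0 : s.exp i = 0
    · rw [vecCoeff_Y_smul_of_eq_zero _ _ _ h0, h.eq_zero s (hlt.trans_eq hs.symm), map_zero,
        D.graded_vecCoeff_Y_smul_of_eq_zero i s h0]
    · obtain ⟨s, rfl⟩ := s.exists_eq_shift_single i h0
      rw [vecCoeff_Y_smul_shift, h.eq_zero (s.shift _) (hlt.trans_eq hs.symm), graded_vecCoeff_Y_smul_shift]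
      rw [hwt, (Term.shift_injective _).eq_iff] at hs
      rw [h.eq s hs, map_zero, add_zero]
  · by_cases h0 : s.exp i = 0
    · rw [D.graded_vecCoeff_Y_smul_of_eq_zero i s h0]
    · obtain ⟨s, rfl⟩ := s.exists_eq_shift_single i h0
      rw [hwt, (Term.shift_injective _).ne_iff] at hs
      rw [graded_vecCoeff_Y_smul_shift, h.homog s hs, map_zero]

theorem C_smul (r : R) (h : D.IsForm wt t f f') :
    D.IsForm wt t (D.monomial 0 r • f) (D.graded.monomial 0 r • f') where
  eq_zero s hs := by rw [vecCoeff_C_smul, h.eq_zero s hs, mul_zero]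
  eq s hs := by rw [vecCoeff_C_smul, vecCoeff_C_smul, h.eq s hs]
  homog s hs := by rw [vecCoeff_C_smul, h.homog s hs, mul_zero]

theorem monomial_smul (hord : IsCompatibleTermOrder ord m)
    (hwt : ∀ w s, wt (s.shift w) = (wt s).shift w) (w : Fin n →₀ ℕ) (r : R)
    (h : D.IsForm wt t f f') :
    D.IsForm wt (t.shift w) (D.monomial w r • f) (D.graded.monomial w r • f') :=
  monomial_smul_induction (P := fun t f f' => D.IsForm wt t f f') (fun r _ _ _ h => h.C_smul r)
    (fun i _ _ _ h => h.Y_smul hord hwt i) w r t f f' h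

end IsForm

end Form

/-! ### Leading terms and leading monomials as forms. -/

section LeadTerm

variable {k m : ℕ} (D : OreData R n) [LinearOrder (Term n m)]

theorem leadTerm_le_iff (f : Fin m → D.Ext) (B : WithBot (Term n m)) :
    D.leadTerm f ≤ B ↔ ∀ s, D.vecCoeff s f ≠ 0 → (s : WithBot (Term n m)) ≤ B := by
  simp only [leadTerm, Finset.sup_le_iff, Finset.mem_univ, true_implies, Finsupp.mem_support_iff]
  exact ⟨fun h s hs => h s.pos s.exp hs, fun h i a ha => h ⟨a, i⟩ ha⟩

theorem leadTerm_lt_iff (f : Fin m → D.Ext) (t : Term n m) :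
    D.leadTerm f < t ↔ ∀ s, D.vecCoeff s f ≠ 0 → s < t := by
  simp only [leadTerm, Finset.sup_lt_iff (WithBot.bot_lt_coe t), Finset.mem_univ, true_implies,
    Finsupp.mem_support_iff, WithBot.coe_lt_coe]
  exact ⟨fun h s hs => h s.pos s.exp hs, fun h i a ha => h ⟨a, i⟩ ha⟩

theorem leadTerm_le_coe_iff (f : Fin m → D.Ext) (t : Term n m) :
    D.leadTerm f ≤ t ↔ ∀ s, D.vecCoeff s f ≠ 0 → s ≤ t := by
  simp only [leadTerm_le_iff, WithBot.coe_le_coe]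

theorem leadTerm_eq_coe_iff (f : Fin m → D.Ext) (t : Term n m) :
    D.leadTerm f = t ↔ D.vecCoeff t f ≠ 0 ∧ ∀ s, D.vecCoeff s f ≠ 0 → s ≤ t := by
  rw [← leadTerm_le_coe_iff]
  refine ⟨fun h => ⟨fun h0 => ?_, h.le⟩, fun h => h.2.antisymm ((D.leadTerm_le_iff f _).1 le_rfl t h.1)⟩
  refine ((D.leadTerm_lt_iff f t).2 fun s hs => ?_).ne h
  refine ((D.leadTerm_le_coe_iff f t).1 h.le s hs).lt_of_ne ?_
  rintro rfl
  exact hs h0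

theorem leadTerm_zero : D.leadTerm (0 : Fin m → D.Ext) = ⊥ :=
  le_bot_iff.1 ((D.leadTerm_le_iff _ _).2 fun _ hs => absurd (map_zero _) hs)

theorem leadTerm_eq_bot_iff (f : Fin m → D.Ext) : D.leadTerm f = ⊥ ↔ f = 0 := by
  refine ⟨fun h => ?_, fun h => h ▸ D.leadTerm_zero⟩
  by_contra hf
  obtain ⟨s, hs⟩ := D.exists_vecCoeff_ne_zero hf
  exact WithBot.not_coe_le_bot s ((D.leadTerm_le_iff f ⊥).1 h.le s hs)

theorem exists_leadTerm_eq {f : Fin m → D.Ext} (hf : f ≠ 0) :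
    ∃ t : Term n m, D.leadTerm f = t :=
  (WithBot.ne_bot_iff_exists.1 fun h => hf ((D.leadTerm_eq_bot_iff f).1 h)).imp fun _ => Eq.symm

theorem leadMonomial_eq {f : Fin m → D.Ext} {t : Term n m} (h : D.leadTerm f = t) :
    D.leadMonomial f = D.vecMonomial (D.vecCoeff t f) t := by
  rw [leadMonomial, h]
  rfl

variable {D} {f : Fin m → D.Ext} {f' : Fin m → D.graded.Ext} {t : Term n m}

/-- With weight `id` only the term `t` itself has weight `t`, so the form is a single monomial, or
zero. -/
theorem isForm_iff_of_leadTerm_le (h : D.leadTerm f ≤ t) :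
    D.IsForm id t f f' ↔ f' = D.toGrVec m (D.vecMonomial (D.vecCoeff t f) t) := by
  classical
  have key : D.IsForm id t f (D.toGrVec m (D.vecMonomial (D.vecCoeff t f) t)) := by
    refine ⟨fun s hs => ?_, fun s (hs : s = t) => ?_, fun s (hs : s ≠ t) => ?_⟩
    · by_contra h0
      exact ((D.leadTerm_le_coe_iff f t).1 h s h0).not_gt hs
    · subst hs
      rw [vecCoeff_toGrVec, vecCoeff_vecMonomial, if_pos rfl]
    · rw [vecCoeff_toGrVec, vecCoeff_vecMonomial, if_neg hs.symm]
  exact ⟨fun h => h.eq_homogPart.trans key.eq_homogPart.symm, fun h => h ▸ key⟩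

theorem isForm_leadMonomial (h : D.leadTerm f = t) :
    D.IsForm id t f (D.toGrVec m (D.leadMonomial f)) :=
  (isForm_iff_of_leadTerm_le h.le).2 (by rw [D.leadMonomial_eq h])

theorem IsForm.leadTerm_le (h : D.IsForm id t f f') : D.leadTerm f ≤ t :=
  (D.leadTerm_le_coe_iff f t).2 fun s hs => not_lt.1 fun h' => hs (h.eq_zero s h')

theorem IsForm.leadTerm_lt (h : D.IsForm id t f 0) : D.leadTerm f < t :=
  (D.leadTerm_lt_iff f t).2 fun _ hs => h.lt_of_ne_zero hs

theorem IsForm.leadTerm_eq (h : D.IsForm id t f f') (hf' : f' ≠ 0) : D.leadTerm f = t := by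
  refine h.leadTerm_le.eq_of_not_lt fun hlt => hf' ?_
  rw [(isForm_iff_of_leadTerm_le h.leadTerm_le).1 h]
  have : D.vecCoeff t f = 0 := by
    by_contra h0
    exact lt_irrefl t ((D.leadTerm_lt_iff f t).1 hlt t h0)
  simp [this, vecMonomial]

theorem IsForm.eq_leadMonomial (h : D.IsForm id t f f') (hf' : f' ≠ 0) :
    f' = D.toGrVec m (D.leadMonomial f) := by
  rw [D.leadMonomial_eq (h.leadTerm_eq hf')]
  exact (isForm_iff_of_leadTerm_le h.leadTerm_le).1 h

end LeadTerm

/-! ### Leading exponents and leading terms of products. -/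

section LeadExp

variable (D : OreData R n) (ord : MonomialOrder (Fin n))

theorem toSyn_le_leadExp {l : D.Ext} {w : Fin n →₀ ℕ} (hw : D.coeff l w ≠ 0) :
    ord.toSyn w ≤ ord.toSyn (D.leadExp ord l) := by
  rw [leadExp, AddEquiv.apply_symm_apply]
  exact Finset.le_sup (f := ord.toSyn) (Finsupp.mem_support_iff.2 hw)

theorem coeff_leadExp_ne_zero {l : D.Ext} (hl : l ≠ 0) : D.coeff l (D.leadExp ord l) ≠ 0 := by
  have hne : (D.coeff l).support.Nonempty :=
    Finsupp.support_nonempty_iff.2 fun h => hl (D.coeff.injective (h.trans (map_zero _).symm))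
  obtain ⟨w, hw, h⟩ := Finset.exists_mem_eq_sup _ hne ord.toSyn
  rw [leadExp, h, AddEquiv.symm_apply_apply]
  exact Finsupp.mem_support_iff.1 hw

theorem leadMon_zero : D.leadMon ord 0 = 0 := by simp [leadMon]

end LeadExp

section LeadTermSmul

variable {m : ℕ} {D : OreData R n} [LinearOrder (Term n m)] {ord : MonomialOrder (Fin n)}

theorem vecCoeff_monomial_smul_of_lt (hord : IsCompatibleTermOrder ord m) {f : Fin m → D.Ext}
    {t s : Term n m} (hf : D.leadTerm f ≤ t) (w : Fin n →₀ ℕ) (r : R) (hs : t.shift w < s) :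
    D.vecCoeff s (D.monomial w r • f) = 0 :=
  (((isForm_iff_of_leadTerm_le hf).2 rfl).monomial_smul hord (fun _ _ => rfl) w r).eq_zero s hs

/-- Each variable applies an injective `αᵢ` to the leading coefficient, and the scalar `r` then
multiplies it in a domain. The vanishing above `t` is carried along the induction to kill the
`δᵢ`-part. -/
theorem vecCoeff_monomial_smul_ne_zero [IsDomain R] (hord : IsCompatibleTermOrder ord m)
    {f : Fin m → D.Ext} {t : Term n m} (hf : D.leadTerm f = t) (w : Fin n →₀ ℕ) {r : R}
    (hr : r ≠ 0) : D.vecCoeff (t.shift w) (D.monomial w r • f) ≠ 0 := by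
  rw [monomial_eq_mul, mul_smul, vecCoeff_C_smul]
  refine mul_ne_zero hr ?_
  refine (term_smul_induction (D := D) (D' := D)
    (P := fun t (x _ : Fin m → D.Ext) =>
      (∀ s, t < s → D.vecCoeff s x = 0) ∧ D.vecCoeff t x ≠ 0)
    (fun i t x _ h => ⟨fun s hs => ?_, ?_⟩) w t f f ⟨fun s hs => ?_, ?_⟩).2
  · refine vecCoeff_monomial_smul_of_lt hord ((D.leadTerm_le_coe_iff x t).2 fun s hs => ?_) _ _ hs
    exact not_lt.1 fun h' => hs (h.1 s h')
  · rw [vecCoeff_Y_smul_shift, h.1 _ (hord.lt_shift_single i t), map_zero, add_zero]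
    exact (map_ne_zero_iff _ (D.α_injective i)).2 h.2
  · by_contra h0
    exact ((D.leadTerm_le_coe_iff f t).1 hf.le s h0).not_gt hs
  · exact ((D.leadTerm_eq_coe_iff f t).1 hf).1

theorem sum_monomial_smul {V : Type*} [AddCommGroup V] [Module D.Ext V] (l : D.Ext) (x : V) :
    l • x = ∑ w ∈ (D.coeff l).support, D.monomial w (D.coeff l w) • x := by
  rw [← Finset.sum_smul, sum_monomial]

/-- By compatibility of the two orderings, every other monomial of `l` sends `f` strictly below the
term reached by the leading one, so nothing can cancel there. -/
theorem leadTerm_smul [IsDomain R] (hord : IsCompatibleTermOrder ord m) {f : Fin m → D.Ext}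
    {t : Term n m} (hf : D.leadTerm f = t) {l : D.Ext} (hl : l ≠ 0) :
    D.leadTerm (l • f) = (t.shift (D.leadExp ord l) : Term n m) := by
  have hl0 := D.coeff_leadExp_ne_zero ord hl
  rw [leadTerm_eq_coe_iff, sum_monomial_smul l f]
  refine ⟨?_, fun s hs => not_lt.1 fun hlt => hs ?_⟩
  · rw [map_sum, Finset.sum_eq_single_of_mem _ (Finsupp.mem_support_iff.2 hl0)]
    · exact vecCoeff_monomial_smul_ne_zero hord hf _ hl0
    · intro w hw hne
      refine vecCoeff_monomial_smul_of_lt hord hf.le _ _ (hord.compatible _ _ _ ?_)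
      exact (D.toSyn_le_leadExp ord (Finsupp.mem_support_iff.1 hw)).lt_of_ne
        (ord.toSyn.injective.ne hne)
  · rw [map_sum]
    refine Finset.sum_eq_zero fun w hw => vecCoeff_monomial_smul_of_lt hord hf.le _ _ ?_
    exact (hord.shift_le_shift_iff.2
      (D.toSyn_le_leadExp ord (Finsupp.mem_support_iff.1 hw))).trans_lt hlt

theorem smul_ne_zero_of_ne_zero [IsDomain R] (hord : IsCompatibleTermOrder ord m)
    {f : Fin m → D.Ext} (hf : f ≠ 0) {l : D.Ext} (hl : l ≠ 0) : l • f ≠ 0 := by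
  obtain ⟨t, ht⟩ := D.exists_leadTerm_eq hf
  rw [Ne, ← leadTerm_eq_bot_iff, leadTerm_smul hord ht hl]
  exact WithBot.coe_ne_bot

theorem leadTerm_smul_le_iff [IsDomain R] (hord : IsCompatibleTermOrder ord m)
    {f : Fin m → D.Ext} {t t' : Term n m} (hf : D.leadTerm f = t) (l : D.Ext) :
    D.leadTerm (l • f) ≤ t' ↔ ∀ w, D.coeff l w ≠ 0 → t.shift w ≤ t' := by
  rcases eq_or_ne l 0 with rfl | hl
  · simp [leadTerm_zero]
  rw [leadTerm_smul hord hf hl, WithBot.coe_le_coe]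
  exact ⟨fun h w hw => (hord.shift_le_shift_iff.2 (D.toSyn_le_leadExp ord hw)).trans h,
    fun h => h _ (D.coeff_leadExp_ne_zero ord hl)⟩

theorem leadTerm_smul_lt_iff [IsDomain R] (hord : IsCompatibleTermOrder ord m)
    {f : Fin m → D.Ext} {t t' : Term n m} (hf : D.leadTerm f = t) (l : D.Ext) :
    D.leadTerm (l • f) < t' ↔ ∀ w, D.coeff l w ≠ 0 → t.shift w < t' := by
  rcases eq_or_ne l 0 with rfl | hl
  · simp [leadTerm_zero]
  rw [leadTerm_smul hord hf hl, WithBot.coe_lt_coe]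
  exact ⟨fun h w hw => (hord.shift_le_shift_iff.2 (D.toSyn_le_leadExp ord hw)).trans_lt h,
    fun h => h _ (D.coeff_leadExp_ne_zero ord hl)⟩

end LeadTermSmul

end OreData


/-! ### The weight on syzygies and the two maps `𝔖_L`, `𝔰_L`. -/

/-- The degree `ω ∘ τᵢ` of the term `ω eᵢ`, where the basis vector `eᵢ` has degree `τᵢ`. -/
def Term.weight {n m u : ℕ} (τ : Fin u → Term n m) (s : Term n u) : Term n m :=
  (τ s.pos).shift s.exp

theorem Term.weight_shift {n m u : ℕ} (τ : Fin u → Term n m) (w : Fin n →₀ ℕ) (s : Term n u) :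
    (s.shift w).weight τ = (s.weight τ).shift w :=
  Term.shift_add _ _ _

namespace OreData

variable {R : Type*} [Ring R] {n m u : ℕ} {D : OreData R n} {ord : MonomialOrder (Fin n)}
  {g : Fin u → Fin m → D.Ext} {τ : Fin u → Term n m} {t : Term n m}

theorem bigS_apply (L : Fin u → D.Ext) : D.bigS g L = ∑ i, L i • g i :=
  Fintype.linearCombination_apply _ _ _

theorem span_range_eq :
    Submodule.span D.Ext (Set.range g) = LinearMap.range (D.bigS g) :=
  (Fintype.range_linearCombination D.Ext g).symm

theorem sum_monomial_of_subset (x : D.Ext) {W : Finset (Fin n →₀ ℕ)}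
    (hW : (D.coeff x).support ⊆ W) : ∑ w ∈ W, D.monomial w (D.coeff x w) = x := by
  refine Eq.trans (Finset.sum_subset hW fun w _ hw => ?_).symm (D.sum_monomial x)
  rw [Finsupp.notMem_support_iff.1 hw, map_zero]

variable [LinearOrder (Term n m)]

theorem smallS_apply (L : Fin u → D.graded.Ext) :
    D.smallS g L = ∑ i, L i • D.toGrVec m (D.leadMonomial (g i)) :=
  Fintype.linearCombination_apply _ _ _

/-- `𝔖_L` maps a vector with form `L'` to a vector with form `𝔰_L(L')`. -/
theorem IsForm.bigS (hord : IsCompatibleTermOrder ord m) (hτ : ∀ i, D.leadTerm (g i) = τ i)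
    {L : Fin u → D.Ext} {L' : Fin u → D.graded.Ext} (h : D.IsForm (Term.weight τ) t L L') :
    D.IsForm id t (D.bigS g L) (D.smallS g L') := by
  classical
  rw [bigS_apply, smallS_apply]
  refine IsForm.sum _ fun i _ => ?_
  -- A common index set for both expansions allows a comparison term by term. A term of weight below
  -- `t` is absent from `L'` and contributes only below `t` on the other side; a term of weight
  -- above `t` is absent from both.
  let W := (D.coeff (L i)).support ∪ (D.graded.coeff (L' i)).support
  rw [← sum_monomial_of_subset (L i) (W := W) subset_union_left,
    ← sum_monomial_of_subset (L' i) (W := W) subset_union_right, Finset.sum_smul, Finset.sum_smul]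
  refine IsForm.sum _ fun w _ => ?_
  have hform := fun r =>
    (isForm_leadMonomial (hτ i)).monomial_smul hord (fun _ _ => rfl) w r
  rcases lt_trichotomy (Term.weight τ ⟨w, i⟩) t with hlt | heq | hgt
  · have h0 : D.graded.coeff (L' i) w = 0 := h.homog ⟨w, i⟩ hlt.ne
    rw [h0, map_zero, zero_smul]
    exact (hform _).zero_of_lt hlt
  · have h0 : D.coeff (L i) w = D.graded.coeff (L' i) w := h.eq ⟨w, i⟩ heq
    rw [← h0, ← heq]
    exact hform _
  · have h0 : D.coeff (L i) w = 0 := h.eq_zero ⟨w, i⟩ hgt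
    have h1 : D.graded.coeff (L' i) w = 0 := h.homog ⟨w, i⟩ hgt.ne'
    rw [h0, h1, map_zero, map_zero, zero_smul, zero_smul]
    exact isForm_zero _ _

theorem isHomogeneousOfDegree_iff (hτ : ∀ i, D.leadTerm (g i) = τ i)
    (σ : Fin u → D.graded.Ext) :
    D.IsHomogeneousOfDegree g t σ ↔
      ∀ s, D.graded.vecCoeff s σ ≠ 0 → Term.weight τ s = t := by
  simp only [IsHomogeneousOfDegree, hτ, WithBot.map_coe, WithBot.coe_inj, Finsupp.mem_support_iff]
  exact ⟨fun h s hs => h s.pos s.exp hs, fun h i w hw => h ⟨w, i⟩ hw⟩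

theorem val_zero : D.val g 0 = ⊥ :=
  le_bot_iff.1 (Finset.sup_le fun i _ => by rw [Pi.zero_apply, zero_smul, leadTerm_zero])

theorem leadForm_zero : D.leadForm ord g 0 = 0 := by
  funext i
  simp [leadForm, leadMon_zero]

theorem hasLifting_zero : D.HasLifting ord g 0 :=
  ⟨0, zero_mem _, leadForm_zero⟩

/-! ### The valuation and the leading form in terms of weights. -/

section Val

variable [IsDomain R]

/-- Since leading terms multiply, the valuation, though defined through the products `hᵢ ⋆ gᵢ`,
depends only on the terms occurring in `σ`. -/
theorem val_le_iff (hord : IsCompatibleTermOrder ord m) (hτ : ∀ i, D.leadTerm (g i) = τ i)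
    (σ : Fin u → D.Ext) :
    D.val g σ ≤ t ↔ ∀ s, D.vecCoeff s σ ≠ 0 → Term.weight τ s ≤ t := by
  simp only [val, Finset.sup_le_iff, Finset.mem_univ, true_implies,
    leadTerm_smul_le_iff hord (hτ _)]
  exact ⟨fun h s hs => h s.pos s.exp hs, fun h i w hw => h ⟨w, i⟩ hw⟩

theorem val_lt_iff (hord : IsCompatibleTermOrder ord m) (hτ : ∀ i, D.leadTerm (g i) = τ i)
    (σ : Fin u → D.Ext) :
    D.val g σ < t ↔ ∀ s, D.vecCoeff s σ ≠ 0 → Term.weight τ s < t := by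
  simp only [val, Finset.sup_lt_iff (WithBot.bot_lt_coe t), Finset.mem_univ, true_implies,
    leadTerm_smul_lt_iff hord (hτ _)]
  exact ⟨fun h s hs => h s.pos s.exp hs, fun h i w hw => h ⟨w, i⟩ hw⟩

theorem val_eq_bot_iff (hord : IsCompatibleTermOrder ord m) (hτ : ∀ i, D.leadTerm (g i) = τ i)
    (σ : Fin u → D.Ext) : D.val g σ = ⊥ ↔ σ = 0 := by
  refine ⟨fun h => funext fun i => ?_, fun h => h ▸ val_zero⟩
  by_contra hi
  have h1 := (Finset.le_sup (f := fun i => D.leadTerm (σ i • g i)) (mem_univ i)).trans h.le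
  rw [leadTerm_smul hord (hτ i) hi] at h1
  exact WithBot.not_coe_le_bot _ h1

theorem IsForm.val_lt (hord : IsCompatibleTermOrder ord m) (hτ : ∀ i, D.leadTerm (g i) = τ i)
    {L : Fin u → D.Ext} (h : D.IsForm (Term.weight τ) t L 0) : D.val g L < t :=
  (val_lt_iff hord hτ L).2 fun _ hs => h.lt_of_ne_zero hs

theorem isForm_homogPart_of_val_le (hord : IsCompatibleTermOrder ord m)
    (hτ : ∀ i, D.leadTerm (g i) = τ i) {L : Fin u → D.Ext} (h : D.val g L ≤ t) :
    D.IsForm (Term.weight τ) t L (D.graded.homogPart (Term.weight τ) t (D.toGrVec u L)) := by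
  refine isForm_homogPart fun s hs => ?_
  by_contra h0
  exact ((val_le_iff hord hτ L).1 h s h0).not_gt hs

theorem IsForm.val_eq (hord : IsCompatibleTermOrder ord m) (hτ : ∀ i, D.leadTerm (g i) = τ i)
    {L : Fin u → D.Ext} {L' : Fin u → D.graded.Ext} (h : D.IsForm (Term.weight τ) t L L')
    (hL' : L' ≠ 0) : D.val g L = t := by
  refine ((val_le_iff hord hτ L).2 fun s hs => not_lt.1 fun h' =>
    hs (h.eq_zero s h')).eq_of_not_lt fun hlt => hL' (D.graded.vec_ext fun s => ?_)
  by_cases hs : Term.weight τ s = t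
  · rw [← h.eq s hs, map_zero]
    by_contra h0
    exact ((val_lt_iff hord hτ L).1 hlt s h0).ne hs
  · rw [h.homog s hs, map_zero]

/-- In component `i` at most one exponent `w` satisfies `w ∘ T(gᵢ) = t`; if it occurs in `L i`, it
is the leading one because `v(L) = t`. So the part of weight `t` consists of leading monomials. -/
theorem leadForm_eq_homogPart (hord : IsCompatibleTermOrder ord m)
    (hτ : ∀ i, D.leadTerm (g i) = τ i) {L : Fin u → D.Ext} (h : D.val g L = t) :
    D.leadForm ord g L = D.graded.homogPart (Term.weight τ) t (D.toGrVec u L) := by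
  refine D.graded.vec_ext fun s => ?_
  obtain ⟨w, i⟩ := s
  have hle := (Finset.le_sup (f := fun i => D.leadTerm (L i • g i)) (mem_univ i)).trans h.le
  have hcoeff : D.graded.vecCoeff ⟨w, i⟩ (D.leadForm ord g L) =
      D.graded.coeff (D.leadForm ord g L i) w := rfl
  rw [vecCoeff_homogPart, vecCoeff_toGrVec, hcoeff, leadForm, h]
  by_cases hi : D.leadTerm (L i • g i) = t
  · rw [if_pos hi, coeff_toGr, leadMon, coeff_monomial]
    have hLi : L i ≠ 0 := fun h0 => by simp [h0, leadTerm_zero] at hi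
    rw [leadTerm_smul hord (hτ i) hLi, WithBot.coe_inj] at hi
    by_cases hw : D.leadExp ord (L i) = w
    · subst hw
      exact (if_pos rfl).trans (if_pos hi).symm
    · rw [if_neg hw, if_neg fun h' => hw (Term.shift_left_injective (τ i) (hi.trans h'.symm))]
  · rw [if_neg hi, map_zero, Finsupp.zero_apply]
    split_ifs with hw
    · by_contra h0
      exact ((leadTerm_smul_lt_iff hord (hτ i) (L i)).1 (hle.lt_of_ne hi) w (Ne.symm h0)).ne hw
    · rfl

/-- Replaces the non-additive leading form by the additive `IsForm`. The case `σ = 0` must be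
excluded: a zero form in degree `t` only says `v(L) < t`. -/
theorem leadForm_eq_iff (hord : IsCompatibleTermOrder ord m) (hτ : ∀ i, D.leadTerm (g i) = τ i)
    {L : Fin u → D.Ext} {σ : Fin u → D.graded.Ext} (hσ : σ ≠ 0)
    (hσt : ∀ s, D.graded.vecCoeff s σ ≠ 0 → Term.weight τ s = t) :
    D.leadForm ord g L = σ ↔ D.IsForm (Term.weight τ) t L σ := by
  refine ⟨fun h => ?_, fun h => ?_⟩
  · have hL : L ≠ 0 := fun h0 => hσ (by rw [← h, h0, leadForm_zero])
    obtain ⟨t', ht'⟩ := WithBot.ne_bot_iff_exists.1 (mt (val_eq_bot_iff hord hτ L).1 hL)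
    have hform := isForm_homogPart_of_val_le hord hτ ht'.symm.le
    rw [← leadForm_eq_homogPart hord hτ ht'.symm, h] at hform
    obtain ⟨s, hs⟩ := D.graded.exists_vecCoeff_ne_zero hσ
    have : t' = t := by
      by_contra hne
      exact hs (hform.homog s (by rw [hσt s hs]; exact Ne.symm hne))
    rwa [← this]
  · rw [leadForm_eq_homogPart hord hτ (h.val_eq hord hτ hσ), ← h.eq_homogPart]

end Val

/-! ### Gröbner bases and Gröbner representations. -/

section Groebner

theorem leadModule_eq (hτ : ∀ i, D.leadTerm (g i) = τ i) :
    D.leadModule (Set.range g) =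
      Submodule.span D.graded.Ext
        (Set.range fun i => D.toGrVec m (D.leadMonomial (g i))) := by
  unfold leadModule
  congr 1
  ext x
  constructor
  · rintro ⟨_, ⟨_, ⟨i, rfl⟩, _, rfl⟩, rfl⟩
    exact ⟨i, rfl⟩
  · rintro ⟨i, rfl⟩
    refine ⟨_, ⟨g i, ⟨i, rfl⟩, fun h0 => ?_, rfl⟩, rfl⟩
    have := hτ i
    rw [h0, leadTerm_zero] at this
    exact WithBot.bot_ne_coe this

theorem smallS_mem_leadModule (hτ : ∀ i, D.leadTerm (g i) = τ i) (L : Fin u → D.graded.Ext) :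
    D.smallS g L ∈ D.leadModule (Set.range g) := by
  rw [leadModule_eq hτ, ← Fintype.range_linearCombination]
  exact ⟨L, rfl⟩

theorem vecCoeff_leadMonomial_ne_zero {f : Fin m → D.Ext} {t : Term n m} (hf : D.leadTerm f = t)
    (s : Term n m) (hs : D.graded.vecCoeff s (D.toGrVec m (D.leadMonomial f)) ≠ 0) : id s = t := by
  by_contra h
  exact hs ((isForm_leadMonomial hf).homog s h)

/-- The homogeneous parts of elements of the module of leading monomials are forms of elements
`𝔖_L(L)` with `L` of value at most the degree. -/
theorem exists_isForm_bigS_of_mem_leadModule (hord : IsCompatibleTermOrder ord m)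
    (hτ : ∀ i, D.leadTerm (g i) = τ i) {h : Fin m → D.graded.Ext}
    (hh : h ∈ D.leadModule (Set.range g)) (t : Term n m) :
    ∃ L L', D.IsForm (Term.weight τ) t L L' ∧
      D.IsForm id t (D.bigS g L) (D.graded.homogPart id t h) := by
  classical
  rw [leadModule_eq hτ] at hh
  refine D.homogPart_span_induction (wt := id) (fun _ _ => rfl)
    (P := fun t h => ∃ L L', D.IsForm (Term.weight τ) t L L' ∧ D.IsForm id t (D.bigS g L) h)
    (fun t => ⟨0, 0, isForm_zero _ _, by rw [map_zero]; exact isForm_zero _ _⟩)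
    ?_ ?_ ?_ hh t
  · rintro t x y ⟨L₁, L₁', h₁, h₁'⟩ ⟨L₂, L₂', h₂, h₂'⟩
    exact ⟨_, _, h₁.add h₂, by rw [map_add]; exact h₁'.add h₂'⟩
  · rintro w r t x ⟨L, L', h, h'⟩
    refine ⟨_, _, h.monomial_smul hord (Term.weight_shift τ) w r, ?_⟩
    rw [map_smul]
    exact h'.monomial_smul hord (fun _ _ => rfl) w r
  · rintro _ ⟨i, rfl⟩ t
    dsimp only
    have hi := isForm_leadMonomial (hτ i)
    rcases eq_or_ne t (τ i) with rfl | ht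
    · rw [D.graded.homogPart_eq_self (vecCoeff_leadMonomial_ne_zero (hτ i))]
      -- The basis vector has the single weight `τ i` and is sent to `g i`, whose form there is its
      -- leading monomial.
      refine ⟨Pi.single i 1, _, isForm_homogPart fun s hs => ?_, ?_⟩
      · rw [vecCoeff_apply]
        rcases eq_or_ne s.pos i with hsi | hsi
        · rw [hsi, Pi.single_eq_same]
          refine (D.coeff_monomial 0 _ 1).trans (if_neg fun h0 => ?_)
          rw [Term.weight, ← h0, Term.shift_zero, hsi] at hs
          exact lt_irrefl _ hs
        · rw [Pi.single_eq_of_ne hsi, map_zero, Finsupp.zero_apply]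
      · rw [bigS, Fintype.linearCombination_apply_single, one_smul]
        exact hi
    · rw [D.graded.homogPart_eq_zero ht (vecCoeff_leadMonomial_ne_zero (hτ i))]
      exact ⟨0, 0, isForm_zero _ _, by rw [map_zero]; exact isForm_zero _ _⟩

/-- The generators are monomials, so each of their homogeneous parts is the generator itself or
zero. -/
theorem homogPart_mem_leadModule (hτ : ∀ i, D.leadTerm (g i) = τ i) {h : Fin m → D.graded.Ext}
    (hh : h ∈ D.leadModule (Set.range g)) (t : Term n m) :
    D.graded.homogPart id t h ∈ D.leadModule (Set.range g) := by
  rw [leadModule_eq hτ] at hh ⊢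
  refine D.homogPart_span_induction (wt := id) (fun _ _ => rfl)
    (P := fun _ h => h ∈ Submodule.span D.graded.Ext
        (Set.range fun i => D.toGrVec m (D.leadMonomial (g i))))
    (fun _ => zero_mem _) (fun _ _ _ => add_mem) (fun w r _ _ h => Submodule.smul_mem _ _ h)
    ?_ hh t
  rintro _ ⟨i, rfl⟩ t
  dsimp only
  rcases eq_or_ne t (τ i) with rfl | ht
  · rw [D.graded.homogPart_eq_self (vecCoeff_leadMonomial_ne_zero (hτ i))]
    exact Submodule.subset_span ⟨i, rfl⟩
  · rw [D.graded.homogPart_eq_zero ht (vecCoeff_leadMonomial_ne_zero (hτ i))]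
    exact zero_mem _

theorem leadMonomial_eq_homogPart {h : Fin m → D.Ext} (ht : D.leadTerm h = t) :
    D.leadMonomial h = D.homogPart id t h := by
  classical
  rw [D.leadMonomial_eq ht]
  refine D.vec_ext fun s => ?_
  rw [vecCoeff_homogPart, vecCoeff_vecMonomial]
  by_cases hs : t = s
  · subst hs; simp
  · rw [if_neg hs, if_neg (show ¬ id s = t from Ne.symm hs)]

theorem leadTerm_vecMonomial {c : R} (hc : c ≠ 0) (t : Term n m) :
    D.leadTerm (D.vecMonomial c t) = t := by
  classical
  refine (D.leadTerm_eq_coe_iff _ _).2 ⟨?_, fun s hs => ?_⟩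
  · rwa [vecCoeff_vecMonomial, if_pos rfl]
  · rw [vecCoeff_vecMonomial] at hs
    exact (ite_ne_right_iff.1 hs).1.ge

theorem leadMonomial_mem_monomials {f : Fin m → D.Ext} (hf : f ≠ 0) :
    D.leadMonomial f ∈ D.monomials m := by
  obtain ⟨t, ht⟩ := D.exists_leadTerm_eq hf
  exact ⟨_, t, ((D.leadTerm_eq_coe_iff f t).1 ht).1, D.leadMonomial_eq ht⟩

theorem vecMonomial_ne_zero {c : R} (hc : c ≠ 0) (t : Term n m) : D.vecMonomial c t ≠ 0 := by
  rw [Ne, ← leadTerm_eq_bot_iff, leadTerm_vecMonomial hc]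
  exact WithBot.coe_ne_bot

theorem leadMonomial_vecMonomial {c : R} (hc : c ≠ 0) (t : Term n m) :
    D.leadMonomial (D.vecMonomial c t) = D.vecMonomial c t := by
  classical
  rw [D.leadMonomial_eq (leadTerm_vecMonomial hc t), vecCoeff_vecMonomial, if_pos rfl]

/-- A finite generating set is a left Gröbner basis as soon as all leading monomials of the module
lie in the module generated by the leading monomials of the generators. -/
theorem isLeftGroebnerBasis_iff [IsDomain R] (hord : IsCompatibleTermOrder ord m)
    (hτ : ∀ i, D.leadTerm (g i) = τ i) :
    D.IsLeftGroebnerBasis (LinearMap.range (D.bigS g)) (Set.range g) ↔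
      ∀ f ∈ LinearMap.range (D.bigS g), f ≠ 0 →
        D.toGrVec m (D.leadMonomial f) ∈ D.leadModule (Set.range g) := by
  -- This clause of the definition is automatic: the module is homogeneous, hence contains the
  -- leading monomials of its elements, and a monomial is its own leading monomial.
  have hgr : D.graded.leadMonomials (D.leadModule (Set.range g) : Set (Fin m → D.graded.Ext)) =
      (D.leadModule (Set.range g) : Set (Fin m → D.graded.Ext)) ∩ D.graded.monomials m := by
    ext x
    constructor
    · rintro ⟨f, hf, hf0, rfl⟩
      refine ⟨?_, leadMonomial_mem_monomials hf0⟩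
      obtain ⟨t, ht⟩ := D.graded.exists_leadTerm_eq hf0
      rw [leadMonomial_eq_homogPart ht]
      exact homogPart_mem_leadModule hτ hf t
    · rintro ⟨hx, c, t, hc, rfl⟩
      exact ⟨_, hx, vecMonomial_ne_zero hc t, (leadMonomial_vecMonomial hc t).symm⟩
  constructor
  · rintro ⟨_, _, h, h'⟩ f hf hf0
    have : D.toGrVec m (D.leadMonomial f) ∈
        D.toGrVec m '' D.leadMonomials (LinearMap.range (D.bigS g) : Set (Fin m → D.Ext)) :=
      ⟨_, ⟨f, hf, hf0, rfl⟩, rfl⟩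
    rw [h, h'] at this
    exact this.1
  · intro h
    refine ⟨?_, ?_, ?_, hgr⟩
    · rw [← span_range_eq]
      exact Submodule.subset_span
    · ext x
      constructor
      · rintro ⟨f, hf, hf0, rfl⟩
        refine ⟨1, 0, one_ne_zero, f, hf, hf0, ?_⟩
        rw [show D.monomial 0 1 = (1 : D.Ext) from rfl, one_smul]
      · rintro ⟨a, w, ha, f, hf, hf0, rfl⟩
        refine ⟨_, Submodule.smul_mem _ _ hf, smul_ne_zero_of_ne_zero hord hf0 fun h0 => ha ?_, rfl⟩
        simpa [coeff_monomial] using DFunLike.congr_fun (congrArg D.coeff h0) w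
    · rw [hgr]
      ext x
      constructor
      · rintro ⟨_, ⟨f, hf, hf0, rfl⟩, rfl⟩
        exact ⟨h f hf hf0, leadMonomial_mem_monomials hf0⟩
      · rintro ⟨hx, c, t, hc, rfl⟩
        -- A monomial of `N` is its own part of degree `t`, hence the form of some `𝔖_L(L)`. Being
        -- nonzero, it is the leading monomial of that element.
        obtain ⟨L, _, -, hL⟩ := exists_isForm_bigS_of_mem_leadModule hord hτ hx t
        rw [← leadMonomial_eq_homogPart (leadTerm_vecMonomial hc t),
          leadMonomial_vecMonomial hc t] at hL
        have hne : D.graded.vecMonomial c t ≠ 0 := vecMonomial_ne_zero hc t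
        refine ⟨_, ⟨D.bigS g L, ⟨L, rfl⟩, fun h0 => ?_, rfl⟩, (hL.eq_leadMonomial hne).symm⟩
        have := hL.leadTerm_eq hne
        rw [h0, leadTerm_zero] at this
        exact WithBot.bot_ne_coe this

/-- The bounds `T(lᵢ) ∘ T(gᵢ) ≤ T(f)` become one bound on the valuation, since `T(lᵢ) ∘ T(gᵢ) = T(lᵢ
⋆ gᵢ)` for `lᵢ ≠ 0`. -/
theorem hasLeftGroebnerRep_iff [IsDomain R] (hord : IsCompatibleTermOrder ord m)
    (hτ : ∀ i, D.leadTerm (g i) = τ i) (f : Fin m → D.Ext) :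
    D.HasLeftGroebnerRep ord g f ↔ ∃ L, D.bigS g L = f ∧ D.val g L ≤ D.leadTerm f := by
  refine exists_congr fun L => and_congr (by rw [bigS_apply, eq_comm]) ?_
  simp only [val, Finset.sup_le_iff, Finset.mem_univ, true_implies]
  refine forall_congr' fun i => ?_
  rcases eq_or_ne (L i) 0 with h0 | h0
  · simp [h0, leadTerm_zero]
  · rw [leadTerm_smul hord (hτ i) h0, hτ, WithBot.map_coe]
    simp [h0]

theorem forall_hasLeftGroebnerRep_of_isLeftGroebnerBasis [IsDomain R]
    (hord : IsCompatibleTermOrder ord m) (hτ : ∀ i, D.leadTerm (g i) = τ i)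
    (h : ∀ f ∈ LinearMap.range (D.bigS g), f ≠ 0 →
      D.toGrVec m (D.leadMonomial f) ∈ D.leadModule (Set.range g))
    (f : Fin m → D.Ext) (hf : f ∈ LinearMap.range (D.bigS g)) :
    ∃ L, D.bigS g L = f ∧ D.val g L ≤ D.leadTerm f := by
  have := hord.wellFounded
  -- Division algorithm: remove the leading monomial by an element of the module with the same form,
  -- and recurse on the smaller leading term.
  induction hB : D.leadTerm f using WellFoundedLT.induction generalizing f with
  | ind B ih =>
    subst hB
    rcases eq_or_ne f 0 with rfl | hf0
    · exact ⟨0, map_zero _, val_zero.trans_le bot_le⟩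
    obtain ⟨t, ht⟩ := D.exists_leadTerm_eq hf0
    obtain ⟨L, L', hL, hSL⟩ := exists_isForm_bigS_of_mem_leadModule hord hτ (h f hf hf0) t
    rw [D.graded.homogPart_eq_self (vecCoeff_leadMonomial_ne_zero ht)] at hSL
    have hsub := (isForm_leadMonomial ht).sub hSL
    rw [sub_self] at hsub
    have hlt := hsub.leadTerm_lt
    obtain ⟨L₁, hL₁, hval⟩ := ih _ (hlt.trans_eq ht.symm) _ (sub_mem hf ⟨L, rfl⟩) rfl
    refine ⟨L₁ + L, by rw [map_add, hL₁, sub_add_cancel], ?_⟩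
    have hform := (isForm_homogPart_of_val_le hord hτ (hval.trans hlt.le)).add hL
    rw [ht]
    exact (val_le_iff hord hτ _).2 fun s hs => not_lt.1 fun h' => hs (hform.eq_zero s h')

/-- With `t = T(f)`, the leading monomial and `𝔰_L` of the weight-`t` part of `L` are both forms of
`f = 𝔖_L(L)` in degree `t`, hence equal. -/
theorem leadMonomial_mem_leadModule_of_val_le [IsDomain R] (hord : IsCompatibleTermOrder ord m)
    (hτ : ∀ i, D.leadTerm (g i) = τ i) {L : Fin u → D.Ext} (hL : D.bigS g L ≠ 0)
    (hval : D.val g L ≤ D.leadTerm (D.bigS g L)) :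
    D.toGrVec m (D.leadMonomial (D.bigS g L)) ∈ D.leadModule (Set.range g) := by
  obtain ⟨t, ht⟩ := D.exists_leadTerm_eq hL
  have hform := (isForm_homogPart_of_val_le hord hτ (hval.trans ht.le)).bigS hord hτ
  rw [(isForm_leadMonomial ht).eq_homogPart, ← hform.eq_homogPart]
  exact smallS_mem_leadModule hτ _

end Groebner

/-! ### Quasi-Gröbner representations and liftings of syzygies. -/

section Lifting

variable [IsDomain R]

theorem hasLeftQuasiGroebnerRep_of_val_le (hord : IsCompatibleTermOrder ord m)
    (hτ : ∀ i, D.leadTerm (g i) = τ i)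
    (h : ∀ f ∈ LinearMap.range (D.bigS g), ∃ L, D.bigS g L = f ∧ D.val g L ≤ D.leadTerm f)
    {σ : Fin u → D.graded.Ext} (hσ : D.IsHomogeneous g σ) (hker : D.smallS g σ = 0) :
    D.HasLeftQuasiGroebnerRep g ((D.toGrVec u).symm σ) := by
  obtain ⟨t, hσt⟩ := hσ
  rw [isHomogeneousOfDegree_iff hτ] at hσt
  rcases eq_or_ne σ 0 with rfl | hσ0
  · exact ⟨0, by simp, by simp⟩
  have hform := isForm_toGrVec_symm hσt
  have hS := hform.bigS hord hτ
  -- The form of `𝔖_L(σ)` in degree `t = v(σ)` is zero, so its leading term is below `t`, and so is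
  -- every summand of a Gröbner representation.
  rw [hker] at hS
  obtain ⟨L, hL, hval⟩ := h _ ⟨(D.toGrVec u).symm σ, rfl⟩
  refine ⟨L, by rw [← hL, bigS_apply], fun i _ => ?_⟩
  rw [hform.val_eq hord hτ hσ0]
  exact (Finset.le_sup (f := fun i => D.leadTerm (L i • g i)) (mem_univ i)).trans_lt
    (hval.trans_lt hS.leadTerm_lt)

theorem hasLifting_of_hasLeftQuasiGroebnerRep (hord : IsCompatibleTermOrder ord m)
    (hτ : ∀ i, D.leadTerm (g i) = τ i) {σ : Fin u → D.graded.Ext} (hσ : D.IsHomogeneous g σ)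
    (h : D.HasLeftQuasiGroebnerRep g ((D.toGrVec u).symm σ)) : D.HasLifting ord g σ := by
  obtain ⟨t, hσt⟩ := hσ
  rw [isHomogeneousOfDegree_iff hτ] at hσt
  rcases eq_or_ne σ 0 with rfl | hσ0
  · exact hasLifting_zero
  have hform := isForm_toGrVec_symm hσt
  obtain ⟨L, hL, hlt⟩ := h
  rw [hform.val_eq hord hτ hσ0] at hlt
  have hL0 : D.IsForm (Term.weight τ) t L 0 := by
    refine IsForm.zero_of_forall_lt ((val_lt_iff hord hτ L).1 ?_)
    refine (Finset.sup_lt_iff (WithBot.bot_lt_coe t)).2 fun i _ => ?_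
    rcases eq_or_ne (L i) 0 with h0 | h0
    · rw [h0, zero_smul, leadTerm_zero]
      exact WithBot.bot_lt_coe t
    · exact hlt i h0
  -- Subtracting the representation gives an element of `ker 𝔖_L`; as `L` has only weights below
  -- `t`, the form is still `σ`.
  refine ⟨(D.toGrVec u).symm σ - L, ?_, (leadForm_eq_iff hord hτ hσ0 hσt).2 ?_⟩
  · rw [LinearMap.mem_ker, map_sub, hL, ← bigS_apply, sub_self]
  · simpa using hform.sub hL0

theorem hasLifting_of_span (hord : IsCompatibleTermOrder ord m)
    (hτ : ∀ i, D.leadTerm (g i) = τ i) {B : Set (Fin u → D.graded.Ext)}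
    (hB : ∀ σ ∈ B, D.IsHomogeneous g σ) (h : ∀ σ ∈ B, D.HasLifting ord g σ)
    {σ : Fin u → D.graded.Ext} (hσ : σ ∈ Submodule.span D.graded.Ext B)
    (hhom : D.IsHomogeneous g σ) : D.HasLifting ord g σ := by
  obtain ⟨t, hσt⟩ := hhom
  rw [isHomogeneousOfDegree_iff hτ] at hσt
  rcases eq_or_ne σ 0 with rfl | hσ0
  · exact hasLifting_zero
  -- Stated for the homogeneous part in an arbitrary degree, the claim can be proved by induction
  -- over the span, whose intermediate elements need not be homogeneous.
  suffices ∃ U, D.bigS g U = 0 ∧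
      D.IsForm (Term.weight τ) t U (D.graded.homogPart (Term.weight τ) t σ) by
    obtain ⟨U, hU, hform⟩ := this
    rw [D.graded.homogPart_eq_self hσt] at hform
    exact ⟨U, hU, (leadForm_eq_iff hord hτ hσ0 hσt).2 hform⟩
  refine D.homogPart_span_induction (wt := Term.weight τ) (Term.weight_shift τ)
    (P := fun t h => ∃ U, D.bigS g U = 0 ∧ D.IsForm (Term.weight τ) t U h)
    (fun t => ⟨0, map_zero _, isForm_zero _ _⟩) ?_ ?_ ?_ hσ t
  · rintro t x y ⟨U₁, h₁, h₁'⟩ ⟨U₂, h₂, h₂'⟩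
    exact ⟨U₁ + U₂, by rw [map_add, h₁, h₂, add_zero], h₁'.add h₂'⟩
  · rintro w r t x ⟨U, hU, hU'⟩
    exact ⟨D.monomial w r • U, by rw [map_smul, hU, smul_zero],
      hU'.monomial_smul hord (Term.weight_shift τ) w r⟩
  · intro b hb t
    obtain ⟨t', hbt⟩ := hB b hb
    rw [isHomogeneousOfDegree_iff hτ] at hbt
    -- A generator contributes only in its own degree and when nonzero, where its lifting is used.
    -- Otherwise its part is zero, lifted by `0`.
    by_cases ht : t = t' ∧ b ≠ 0
    · obtain ⟨rfl, hb0⟩ := ht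
      obtain ⟨U, hU, hlead⟩ := h b hb
      rw [D.graded.homogPart_eq_self hbt]
      exact ⟨U, hU, (leadForm_eq_iff hord hτ hb0 hbt).1 hlead⟩
    · have : D.graded.homogPart (Term.weight τ) t b = 0 := by
        rcases not_and_or.1 ht with ht | hb0
        · exact D.graded.homogPart_eq_zero ht hbt
        · rw [not_not.1 hb0, homogPart_zero]
      rw [this]
      exact ⟨0, map_zero _, isForm_zero _ _⟩

theorem exists_val_le_leadTerm_of_hasLifting (hord : IsCompatibleTermOrder ord m)
    (hτ : ∀ i, D.leadTerm (g i) = τ i)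
    (h : ∀ σ ∈ LinearMap.ker (D.smallS g), D.IsHomogeneous g σ → D.HasLifting ord g σ)
    (f : Fin m → D.Ext) (hf : f ∈ LinearMap.range (D.bigS g)) :
    ∃ L, D.bigS g L = f ∧ D.val g L ≤ D.leadTerm f := by
  obtain ⟨L, hL⟩ := hf
  have := hord.wellFounded
  -- Start from any `L` over `f` and lower `v(L)` until it no longer exceeds `T(f)`.
  induction hB : D.val g L using WellFoundedLT.induction generalizing L with
  | ind B ih =>
    subst hB
    by_cases hle : D.val g L ≤ D.leadTerm f
    · exact ⟨L, hL, hle⟩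
    have hlt := not_le.1 hle
    obtain ⟨t, ht⟩ := WithBot.ne_bot_iff_exists.1 (bot_le.trans_lt hlt).ne'
    have hform := isForm_homogPart_of_val_le hord hτ ht.symm.le
    set σ := D.graded.homogPart (Term.weight τ) t (D.toGrVec u L) with hσ
    have hσt : ∀ s, D.graded.vecCoeff s σ ≠ 0 → Term.weight τ s = t := fun s hs => by
      by_contra hne
      exact hs (hform.homog s hne)
    -- As `T(f) < t`, the form of `f = 𝔖_L(L)` in degree `t` is zero; by uniqueness it is also
    -- `𝔰_L(σ)`.
    have hker : D.smallS g σ = 0 := by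
      have h1 := hform.bigS hord hτ
      rw [hL] at h1
      have h2 : D.IsForm id t f 0 :=
        IsForm.zero_of_forall_lt ((D.leadTerm_lt_iff f t).1 (hlt.trans_eq ht.symm))
      rw [h1.eq_homogPart, ← h2.eq_homogPart]
    have hσ0 : σ ≠ 0 := fun h0 => by
      rw [h0] at hform
      exact (hform.val_lt hord hτ).ne ht.symm
    obtain ⟨U, hU, hlead⟩ := h σ hker ⟨t, (isHomogeneousOfDegree_iff hτ σ).2 hσt⟩
    -- `L` and the lifting `U` share the form `σ`, so `L - U` has smaller value and the same image
    -- `f`.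
    have hsub := hform.sub ((leadForm_eq_iff hord hτ hσ0 hσt).1 hlead)
    rw [sub_self] at hsub
    exact ih _ ((hsub.val_lt hord hτ).trans_eq ht) (L - U)
      (by rw [map_sub, hL, LinearMap.mem_ker.1 hU, sub_zero]) rfl

end Lifting

end OreData

end

/-! ### The equivalences. -/

theorem mainTheorem1 {R : Type*} [Ring R] [IsDomain R] {n m u : ℕ} (D : OreData R n)
    (ord : MonomialOrder (Fin n)) [LinearOrder (Term n m)] (hord : IsCompatibleTermOrder ord m)
    (g : Fin u → Fin m → D.Ext) (hg : ∀ i, g i ≠ 0)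
    (M : Submodule D.Ext (Fin m → D.Ext)) (hM : Submodule.span D.Ext (Set.range g) = M)
    (GM : Set (Fin u → D.graded.Ext)) (hGM : D.IsGebauerMoellerSet g GM) :
    List.TFAE [
      D.IsLeftGroebnerBasis M (Set.range g),
      ∀ f : Fin m → D.Ext, f ∈ M ↔ D.HasLeftGroebnerRep ord g f,
      ∀ σ ∈ GM, D.HasLeftQuasiGroebnerRep g ((D.toGrVec u).symm σ),
      ∀ σ ∈ GM, D.HasLifting ord g σ,
      ∀ σ ∈ LinearMap.ker (D.smallS g), D.IsHomogeneous g σ → D.HasLifting ord g σ] := by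
  choose τ hτ using fun i => D.exists_leadTerm_eq (hg i)
  obtain ⟨hhom, hspan⟩ := hGM
  have hGMker : ∀ σ ∈ GM, D.smallS g σ = 0 := fun σ hσ =>
    LinearMap.mem_ker.1 (hspan ▸ Submodule.subset_span hσ)
  rw [OreData.span_range_eq] at hM
  subst hM
  -- One direction of condition 2 is free: anything with a representation lies in the module.
  have hrep : (∀ f : Fin m → D.Ext, f ∈ LinearMap.range (D.bigS g) ↔
      D.HasLeftGroebnerRep ord g f) ↔
      ∀ f ∈ LinearMap.range (D.bigS g), ∃ L, D.bigS g L = f ∧ D.val g L ≤ D.leadTerm f := by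
    simp only [OreData.hasLeftGroebnerRep_iff hord hτ]
    exact ⟨fun h f => (h f).1, fun h f => ⟨h f, fun ⟨L, hL, _⟩ => ⟨L, hL⟩⟩⟩
  rw [hrep, OreData.isLeftGroebnerBasis_iff hord hτ]
  tfae_have 1 → 2 := OreData.forall_hasLeftGroebnerRep_of_isLeftGroebnerBasis hord hτ
  tfae_have 2 → 1 := by
    intro h f hf hf0
    obtain ⟨L, rfl, hval⟩ := h f hf
    exact OreData.leadMonomial_mem_leadModule_of_val_le hord hτ hf0 hval
  tfae_have 2 → 3 := fun h σ hσ =>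
    OreData.hasLeftQuasiGroebnerRep_of_val_le hord hτ h (hhom σ hσ) (hGMker σ hσ)
  tfae_have 3 → 4 := fun h σ hσ =>
    OreData.hasLifting_of_hasLeftQuasiGroebnerRep hord hτ (hhom σ hσ) (h σ hσ)
  tfae_have 4 → 5 := fun h σ hσ =>
    OreData.hasLifting_of_span hord hτ hhom h (hspan.symm ▸ hσ)
  tfae_have 5 → 2 := OreData.exists_val_le_leadTerm_of_hasLifting hord hτ
  tfae_finish
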